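/- **Setting.** Graphs are infinite, connected, simple and undirected, with countable vertex set $v(G)$ and finite vertex degrees; $X=(X_n)_{n\ge 0}$ is the simple random walk, $\mathbb P_x$ its law started from $x$, and $T_A=\inf\{n\ge 0: X_n\in A\}$. For a nonempty finite $A\subset v(G)$ put $$\mathrm{Gr}_A(x,y)=\mathbb E_x\Big[\sum_{n=0}^{T_A-1}\mathbf 1_{\{X_n=y\}}\Big],\qquad g_A(x,y)=\frac{\mathrm{Gr}_A(x,y)}{\deg(y)},\qquad a_A(x,y)=g_A(y,y)-g_A(x,y).$$ The potential kernel of the rooted graph $(G,o)$ is *well defined* if there is a function $a:v(G)\times v(G)\to\mathbb R$, called the potential kernel, such that $a_{A_n}(x,y)\to a(x,y)$ for all $x,y$ and for every sequence of finite nonempty sets $A_n$ with $d(A_n,o)\to\infty$. In that case let $\Lambda_a(z,R)=\{x\in v(G):a(x,z)\le R\}$. For a finite set $B$ of vertices and $w\in B$ let $\mathrm{hm}_B(w)=\lim_{z\to\infty}\mathbb P_z(X_{T_B}=w)$ when this limit exists (harmonic measure from infinity), and write $\mathrm{hm}_{o,x}=\mathrm{hm}_{\{o,x\}}$. The rooted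 graph $(G,o)$ is *$\delta$-good* if for every $\varepsilon>0$ there are infinitely many vertices $x$ for which $\mathrm{hm}_{o,x}(x)$ exists and is at least $\delta-\varepsilon$. A random rooted graph $(G,o)$ (a random variable in the space of isomorphism classes of rooted graphs) is *reversible* if $(G,o,X_1)$ and $(G,X_1,o)$ have the same law as random isomorphism classes of graphs with two distinguished vertices, where, given $(G,o)$, $X_1$ is the first step of the walk started from $o$. **Proposition.** Let $(G,o)$ be a reversible random graph that is a.s. recurrent and whose potential kernel is a.s. well defined. Then almost surely: 1. for every $z\in v(G)$ and every real $R\ge 1$ the set $\Lambda_a(z,R)$ is finite, so that $(\Lambda_a(z,R))_{R\ge 1}$ is an exhaustion of $G$ (an increasing family of finite sets with union $v(G)$), and $a(x,z)\to\infty$ as $x\to\infty$; 2. $(G,o)$ is $\delta$-good for every $0\le\delta<\tfrac12$. -/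

import Mathlib

open MeasureTheory Filter Topology
open scoped ENNReal

noncomputable section

namespace PotKer

/-! ### Simple random walk on a deterministic graph -/

section Walk

variable {V : Type*}

/-- The degree of a vertex (meaningful when the neighbourhood is finite). -/
def deg (G : SimpleGraph V) (x : V) : ℕ := (G.neighborSet x).ncard

open Classical in
/-- The transition probability `p(x, y)` of simple random walk: `1 / deg x` for each neighbour. -/
def step (G : SimpleGraph V) (x y : V) : ℝ≥0∞ :=
  if G.Adj x y then (deg G x : ℝ≥0∞)⁻¹ else 0

open Classical in
/-- `ℙ_x (X_0 = p 0, …, X_n = p n)` for the simple random walk `X` started at `x`. -/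
def pathProb (G : SimpleGraph V) (x : V) {n : ℕ} (p : Fin (n + 1) → V) : ℝ≥0∞ :=
  (if p 0 = x then 1 else 0) * ∏ i : Fin n, step G (p i.castSucc) (p i.succ)

/-- `ℙ_x ((X_0, …, X_n) ∈ E)` for the simple random walk `X` started at `x`. -/
def walkProb (G : SimpleGraph V) (x : V) (n : ℕ) (E : Set (Fin (n + 1) → V)) : ℝ≥0∞ :=
  ∑' p : Fin (n + 1) → V, E.indicator (pathProb G x) p

/-- `ℙ_x (T_x^+ < ∞)`, as the sum over `n` of `ℙ_x (T_x^+ = n + 1)`, where `T_x^+` is the first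
return time to `x`. -/
def returnProb (G : SimpleGraph V) (x : V) : ℝ≥0∞ :=
  ∑' n : ℕ, walkProb G x (n + 1)
    {p | p (Fin.last (n + 1)) = x ∧ ∀ i, i ≠ 0 → i ≠ Fin.last (n + 1) → p i ≠ x}

/-- Recurrence: from every vertex the walk returns almost surely. -/
def IsRecurrent (G : SimpleGraph V) : Prop := ∀ x, returnProb G x = 1

/-- The Green function `Gr_A(x, y) = 𝔼_x [∑_{n < T_A} 1{X_n = y}] = ∑_n ℙ_x (X_n = y, n < T_A)`,
where `T_A` is the hitting time of `A` (time `0` included). -/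
def green (G : SimpleGraph V) (A : Set V) (x y : V) : ℝ≥0∞ :=
  ∑' n : ℕ, walkProb G x n {p | p (Fin.last n) = y ∧ ∀ i, p i ∉ A}

/-- The normalised Green function `g_A(x, y) = Gr_A(x, y) / deg y`. In a connected locally finite
graph the Green function is finite for nonempty `A`. -/
def normGreen (G : SimpleGraph V) (A : Set V) (x y : V) : ℝ :=
  (green G A x y).toReal / deg G y

/-- `a_A(x, y) = g_A(y, y) - g_A(x, y)`. -/
def truncPotential (G : SimpleGraph V) (A : Set V) (x y : V) : ℝ :=
  normGreen G A y y - normGreen G A x y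

/-- The distance `d(A_n, o) = min_{v ∈ A_n} d(v, o)` tends to infinity. -/
def GoesToInfinity (G : SimpleGraph V) (o : V) (A : ℕ → Finset V) : Prop :=
  ∀ r : ℕ, ∀ᶠ n in atTop, ∀ v ∈ A n, r ≤ G.dist o v

/-- `a` is the potential kernel of `G`: for every sequence of finite nonempty sets going to
infinity, the truncated kernels converge pointwise to `a`. The limit is thus required not to depend
on the sequence. -/
def IsPotentialKernel (G : SimpleGraph V) (o : V) (a : V → V → ℝ) : Prop :=
  ∀ A : ℕ → Finset V, (∀ n, (A n).Nonempty) → GoesToInfinity G o A →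
    ∀ x y, Tendsto (fun n => truncPotential G (A n : Set V) x y) atTop (𝓝 (a x y))

/-- The sublevel set `Λ_a(z, R) = {x : a(x, z) ≤ R}`. -/
def sublevel (a : V → V → ℝ) (z : V) (R : ℝ) : Set V := {x | a x z ≤ R}

/-- An exhaustion `(S_R)_{R ≥ 1}`: an increasing family of finite sets of vertices covering the
whole vertex set. -/
def IsExhaustion (S : ℝ → Set V) : Prop :=
  (∀ R, 1 ≤ R → (S R).Finite) ∧ (∀ R R', 1 ≤ R → R ≤ R' → S R ⊆ S R') ∧
    ∀ x, ∃ R, 1 ≤ R ∧ x ∈ S R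

/-- `ℙ_z (T_B < ∞, X_{T_B} = w)` for `w ∈ B`. -/
def hitProb (G : SimpleGraph V) (B : Set V) (z w : V) : ℝ≥0∞ :=
  ∑' n : ℕ, walkProb G z n {p | p (Fin.last n) = w ∧ ∀ i, i ≠ Fin.last n → p i ∉ B}

/-- The harmonic measure from infinity of `B` is well defined at `w ∈ B` and has value `h`:
`ℙ_z (X_{T_B} = w) → h` as the starting point `z` goes to infinity. -/
def HasHarmonicMeasureAt (G : SimpleGraph V) (B : Set V) (w : V) (h : ℝ) : Prop :=
  Tendsto (fun z => hitProb G B z w) cofinite (𝓝 (ENNReal.ofReal h)) ∧ 0 ≤ h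

/-- `(G, o)` is `δ`-good: for each `ε > 0` there are infinitely many vertices `x` with
`hm_{o,x}(x) ≥ δ - ε`. -/
def IsDeltaGood (G : SimpleGraph V) (o : V) (δ : ℝ) : Prop :=
  ∀ ε : ℝ, 0 < ε → {x | ∃ h, HasHarmonicMeasureAt G {o, x} x h ∧ δ - ε ≤ h}.Infinite

end Walk

/-! ### Random rooted graphs -/

/-- An infinite connected locally finite rooted graph with a countable vertex set, which is
labelled by `ℕ`. -/
structure RootedGraph where
  graph : SimpleGraph ℕ
  connected : graph.Connected
  locallyFinite : ∀ x, (graph.neighborSet x).Finite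
  root : ℕ

/-- A rooted graph with a second distinguished vertex. -/
structure BirootedGraph extends RootedGraph where
  second : ℕ

/-- Labelled graphs carry the σ-algebra generated by adjacencies and root. -/
instance : MeasurableSpace RootedGraph :=
  MeasurableSpace.comap (fun G => ((fun x y => G.graph.Adj x y : ℕ → ℕ → Prop), G.root)) inferInstance

instance : MeasurableSpace BirootedGraph :=
  MeasurableSpace.comap (fun G => (G.toRootedGraph, G.second)) inferInstance

/-- Isomorphism of rooted graphs. -/
instance rootedSetoid : Setoid RootedGraph where
  r G H := ∃ φ : G.graph ≃g H.graph, φ G.root = H.root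
  iseqv :=
    { refl := fun G => ⟨SimpleGraph.Iso.refl, rfl⟩
      symm := by
        rintro G H ⟨φ, h⟩
        exact ⟨φ.symm, by rw [← h]; exact φ.symm_apply_apply _⟩
      trans := by
        rintro G H K ⟨φ, h⟩ ⟨ψ, h'⟩
        exact ⟨φ.trans ψ, by rw [← h', ← h]; rfl⟩ }

/-- Isomorphism of graphs with two distinguished vertices. -/
instance birootedSetoid : Setoid BirootedGraph where
  r G H := ∃ φ : G.graph ≃g H.graph, φ G.root = H.root ∧ φ G.second = H.second
  iseqv :=
    { refl := fun G => ⟨SimpleGraph.Iso.refl, rfl, rfl⟩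
      symm := by
        rintro G H ⟨φ, h, k⟩
        exact ⟨φ.symm, by rw [← h]; exact φ.symm_apply_apply _,
          by rw [← k]; exact φ.symm_apply_apply _⟩
      trans := by
        rintro G H K ⟨φ, h, k⟩ ⟨ψ, h', k'⟩
        exact ⟨φ.trans ψ, by rw [← h', ← h]; rfl, by rw [← k', ← k]; rfl⟩ }

/-- The space of isomorphism classes of rooted graphs, with the quotient σ-algebra, that is, the
σ-algebra of isomorphism invariant measurable events. It is the Borel σ-algebra of the local
topology, since a countably separated σ-algebra for which a surjection from a standard
Borel space is measurable is the quotient σ-algebra. -/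
abbrev RootedClass : Type := Quotient rootedSetoid

/-- The space of isomorphism classes of graphs with two distinguished vertices, with the
quotient σ-algebra. -/
abbrev BirootedClass : Type := Quotient birootedSetoid

/-- The class of `(G, x, y)`. -/
def RootedGraph.birootedClass (G : RootedGraph) (x y : ℕ) : BirootedClass :=
  Quotient.mk birootedSetoid ⟨⟨G.graph, G.connected, G.locallyFinite, x⟩, y⟩

/-- Random rooted graphs `(G, o)`, given as a choice of a labelled graph in the isomorphism
class: only the isomorphism class is a random variable, the labelling is arbitrary. -/
def IsRandomRootedGraph {Ω : Type*} [MeasurableSpace Ω] (G : Ω → RootedGraph) : Prop :=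
  Measurable fun ω => (Quotient.mk rootedSetoid (G ω) : RootedClass)

/-- Reversibility: `(G, o, X_1)` and `(G, X_1, o)` have the same law on the space of
isomorphism classes of doubly rooted graphs, where, given `(G, o)`, the vertex `X_1` is the first
step of the simple random walk from `o`. -/
def IsReversible {Ω : Type*} [MeasurableSpace Ω] (μ : Measure Ω) (G : Ω → RootedGraph) : Prop :=
  ∀ E : Set BirootedClass, MeasurableSet E →
    ∫⁻ ω, ∑' x : ℕ, step (G ω).graph (G ω).root x *
        E.indicator 1 ((G ω).birootedClass (G ω).root x) ∂μ =
    ∫⁻ ω, ∑' x : ℕ, step (G ω).graph (G ω).root x *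
        E.indicator 1 ((G ω).birootedClass x (G ω).root) ∂μ

end PotKer

end

/-!
Write `g_z` for the normalised Green function of the walk killed at a single vertex `z`. In a
connected recurrent graph bounded functions obey the maximum principle off any nonempty set
(`IsNice.nonpos_of_subharmonic`), and so are determined there by their Laplacian and their boundary
values. Since `g_z` is symmetric and the walk is absorbed at `z` almost surely, this identifies the
truncated potential, `a_z(x, y) = g_y(x, z)` (`IsNice.truncPotential_eq`), and with the effective
resistance `R(x, y) = g_y(x, x)` gives `a_z(x, y) + a_z(y, x) = R(x, y)` and
`ℙ_z (T_x < T_y) = a_z(x, y) / R(x, y)`. Letting `z → ∞`, the harmonic measure from infinity of `x`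
in `{o, x}` exists and equals `a(x, o) / R(x, o)` (`IsNice.tendsto_hitProb`).

By recurrence `R(x, o) → ∞` as `x → ∞` (`IsNice.tendsto_resistance`), while changing the root `o`
changes `a(x, o)` and `R(x, o)` by a bounded amount. Hence the upper limit `hmLimsup` of
`a(x, o) / R(x, o)` as `x → ∞` does not depend on `o` (`IsNice.hmLimsup_eq`).

Everything follows once `hmLimsup ≥ 1/2` almost surely. The graph is then `δ`-good for each
`δ < 1/2`. Moreover `a(x, z) ≥ ℙ_x (T_w < T_z) a(w, z)`, since `a(·, z)` is superharmonic off `z`;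
choosing `w` far away with harmonic measure at least `1/4`, the probability is at least `1/4` for
all but finitely many `x`, and `a(w, z) ≥ R(w, z) / 4` is as large as desired
(`IsNice.tendsto_kernel`).

That `hmLimsup ≥ 1/2` is where reversibility enters (`IsReversible.half_le_hmLimsup`). The harmonic
measures of `o` and `X_n` in `{o, X_n}` add up to one, and `(G, o, X_n)` has the law of
`(G, X_n, o)`. So on the root-independent event `hmLimsup < 1/2`, the vertex `X_n` has harmonic
measure at least `1/2` with conditional probability at least `1/2`, for every `n`. On this event
there are only finitely many such vertices, and the walk spends a vanishing proportion of time in a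
finite set (`IsNice.tendsto_cesaro_finite`), so the event is null.
-/

noncomputable section

namespace PotKer

/-! ### First-step and last-step decompositions of the walk -/

section WalkRecursion

variable {V : Type*} {G : SimpleGraph V}

theorem walkProb_zero (x : V) (E : Set (Fin 1 → V)) :
    walkProb G x 0 E = E.indicator 1 (fun _ => x) := by
  classical
  unfold walkProb
  rw [tsum_eq_single (fun _ => x)]
  · by_cases hx : (fun _ => x) ∈ E <;> simp [hx, pathProb]
  · intro p hp
    have h0 : p 0 ≠ x := fun h => hp (by ext i; rw [Fin.fin_one_eq_zero i, h])
    simp [Set.indicator, pathProb, h0]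

/-- The Markov property at time `1`. -/
theorem walkProb_succ (x : V) (n : ℕ) (E : Set (Fin (n + 2) → V)) :
    walkProb G x (n + 1) E =
      ∑' v, step G x v * walkProb G v n {q | (Fin.cons x q : Fin (n + 2) → V) ∈ E} := by
  classical
  unfold walkProb
  rw [← (Fin.consEquiv (fun _ : Fin (n + 2) => V)).tsum_eq, ENNReal.tsum_prod (f := fun a q =>
      E.indicator (pathProb G x) (Fin.consEquiv (fun _ : Fin (n + 2) => V) (a, q))),
    tsum_eq_single x]
  · simp_rw [← ENNReal.tsum_mul_left]
    rw [ENNReal.tsum_comm]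
    refine tsum_congr fun q => ?_
    rw [tsum_eq_single (q 0)]
    · by_cases hq : (Fin.cons x q : Fin (n + 2) → V) ∈ E
      · simp [Fin.consEquiv, Set.indicator, hq, pathProb, Fin.prod_univ_succ]
      · simp [Fin.consEquiv, Set.indicator, hq]
    · intro v hv
      simp [Set.indicator, pathProb, hv.symm]
  · intro v hv
    refine ENNReal.tsum_eq_zero.2 fun q => ?_
    simp [Fin.consEquiv, Set.indicator, pathProb, hv]

theorem walkProb_empty (x : V) (n : ℕ) : walkProb G x n ∅ = 0 := by
  simp [walkProb]

/-- `ℙ_x (X_n = y, n < T_A)`, the `n`-th term of the Green function. -/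
def killed (G : SimpleGraph V) (A : Set V) (n : ℕ) (x y : V) : ℝ≥0∞ :=
  walkProb G x n {p | p (Fin.last n) = y ∧ ∀ i, p i ∉ A}

/-- `ℙ_x (T_B = n, X_n = w)` for `w ∈ B`, the `n`-th term of `hitProb`. -/
def hitAt (G : SimpleGraph V) (B : Set V) (n : ℕ) (x w : V) : ℝ≥0∞ :=
  walkProb G x n {p | p (Fin.last n) = w ∧ ∀ i, i ≠ Fin.last n → p i ∉ B}

theorem green_eq_tsum (A : Set V) (x y : V) : green G A x y = ∑' n, killed G A n x y := rfl

theorem hitProb_eq_tsum (B : Set V) (x w : V) : hitProb G B x w = ∑' n, hitAt G B n x w := rfl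

open Classical in
theorem killed_zero (A : Set V) (x y : V) :
    killed G A 0 x y = if x = y ∧ x ∉ A then 1 else 0 := by
  simp [killed, walkProb_zero, Set.indicator]

open Classical in
theorem killed_succ (A : Set V) (n : ℕ) (x y : V) :
    killed G A (n + 1) x y = if x ∈ A then 0 else ∑' v, step G x v * killed G A n v y := by
  unfold killed
  rw [walkProb_succ]
  split_ifs with hx
  · refine ENNReal.tsum_eq_zero.2 fun v => ?_
    have : {q : Fin (n + 1) → V | (Fin.cons x q : Fin (n + 2) → V) ∈
        {p : Fin (n + 2) → V | p (Fin.last (n + 1)) = y ∧ ∀ i, p i ∉ A}} = ∅ := by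
      ext q
      simp only [Set.mem_ofPred_eq, Set.mem_empty_iff_false, iff_false, not_and, not_forall]
      exact fun _ => ⟨0, by simpa using hx⟩
    rw [this, walkProb_empty, mul_zero]
  · refine tsum_congr fun v => ?_
    congr 2
    ext q
    simp [Fin.forall_fin_succ, ← Fin.succ_last, hx]

open Classical in
theorem hitAt_zero (B : Set V) (x w : V) : hitAt G B 0 x w = if x = w then 1 else 0 := by
  simp [hitAt, walkProb_zero, Set.indicator, Subsingleton.elim _ (0 : Fin 1)]

open Classical in
theorem hitAt_succ (B : Set V) (n : ℕ) (x w : V) :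
    hitAt G B (n + 1) x w = if x ∈ B then 0 else ∑' v, step G x v * hitAt G B n v w := by
  unfold hitAt
  rw [walkProb_succ]
  split_ifs with hx
  · refine ENNReal.tsum_eq_zero.2 fun v => ?_
    have : {q : Fin (n + 1) → V | (Fin.cons x q : Fin (n + 2) → V) ∈
        {p : Fin (n + 2) → V | p (Fin.last (n + 1)) = w ∧
          ∀ i, i ≠ Fin.last (n + 1) → p i ∉ B}} = ∅ := by
      ext q
      simp only [Set.mem_ofPred_eq, Set.mem_empty_iff_false, iff_false, not_and, not_forall]
      exact fun _ => ⟨0, (Fin.last_pos).ne, by simpa using hx⟩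
    rw [this, walkProb_empty, mul_zero]
  · refine tsum_congr fun v => ?_
    congr 2
    ext q
    simp [Fin.forall_fin_succ, ← Fin.succ_last, hx]

theorem returnProb_eq (x : V) :
    returnProb G x = ∑' v, step G x v * hitProb G {x} v x := by
  simp_rw [returnProb, hitProb_eq_tsum, ← ENNReal.tsum_mul_left]
  rw [ENNReal.tsum_comm]
  refine tsum_congr fun n => ?_
  rw [walkProb_succ]
  refine tsum_congr fun v => ?_
  unfold hitAt
  congr 2
  ext q
  simp [Fin.forall_fin_succ, ← Fin.succ_last]

open Classical in
/-- Decomposition of the killed walk at its last step. -/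
theorem killed_succ_right (A : Set V) (n : ℕ) (x y : V) :
    killed G A (n + 1) x y = if y ∈ A then 0 else ∑' v, killed G A n x v * step G v y := by
  induction n generalizing x with
  | zero =>
    rw [killed_succ]
    by_cases hx : x ∈ A
    · simp [hx, killed_zero]
    · by_cases hy : y ∈ A
      · rw [if_neg hx, if_pos hy]
        refine ENNReal.tsum_eq_zero.2 fun v => ?_
        rw [killed_zero, if_neg, mul_zero]
        rintro ⟨rfl, h⟩; exact h hy
      · rw [if_neg hx, if_neg hy, tsum_eq_single y, tsum_eq_single x]
        · simp [killed_zero, hx, hy]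
        · intro v hv; simp [killed_zero, hv.symm]
        · intro v hv; simp [killed_zero, hv]
  | succ n ih =>
    rw [killed_succ]
    simp_rw [ih]
    by_cases hy : y ∈ A
    · simp [hy]
    simp only [hy, if_false]
    by_cases hx : x ∈ A
    · simp [hx, killed_succ]
    simp only [hx, if_false, killed_succ _ n x, ← ENNReal.tsum_mul_left, ← ENNReal.tsum_mul_right]
    rw [ENNReal.tsum_comm]
    simp only [mul_assoc]

open Classical in
/-- Decomposition of the first hitting of `z` at the last step before it. -/
theorem hitAt_singleton_succ (z : V) (n : ℕ) (x : V) :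
    hitAt G {z} (n + 1) x z = ∑' v, killed G {z} n x v * step G v z := by
  induction n generalizing x with
  | zero =>
    rw [hitAt_succ]
    by_cases hx : x = z
    · simp [hx, killed_zero]
    · rw [if_neg (by simpa using hx), tsum_eq_single z, tsum_eq_single x]
      · simp [killed_zero, hitAt_zero, hx]
      · intro v hv; simp [killed_zero, hv.symm]
      · intro v hv; simp [hitAt_zero, hv]
  | succ n ih =>
    rw [hitAt_succ]
    simp_rw [ih]
    by_cases hx : x = z
    · simp [hx, killed_succ]
    have hx' : x ∉ ({z} : Set V) := by simpa using hx
    simp only [hx', if_false, killed_succ _ n x, ← ENNReal.tsum_mul_left,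
      ← ENNReal.tsum_mul_right]
    rw [ENNReal.tsum_comm]
    simp only [mul_assoc]

open Classical in
theorem hitProb_eq (B : Set V) {w : V} (hw : w ∈ B) (x : V) :
    hitProb G B x w = if x ∈ B then (if x = w then 1 else 0)
      else ∑' v, step G x v * hitProb G B v w := by
  simp_rw [hitProb_eq_tsum]
  rw [tsum_eq_zero_add' ENNReal.summable, hitAt_zero]
  simp_rw [hitAt_succ]
  by_cases hx : x ∈ B
  · simp [hx]
  · have : x ≠ w := fun h => hx (h ▸ hw)
    simp only [hx, this, if_false, zero_add, ← ENNReal.tsum_mul_left]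
    rw [ENNReal.tsum_comm]

theorem hitProb_self {B : Set V} {w : V} (hw : w ∈ B) : hitProb G B w w = 1 := by
  rw [hitProb_eq B hw, if_pos hw, if_pos rfl]

theorem hitProb_of_mem_of_ne {B : Set V} {x w : V} (hw : w ∈ B) (hx : x ∈ B) (hxw : x ≠ w) :
    hitProb G B x w = 0 := by
  rw [hitProb_eq B hw, if_pos hx, if_neg hxw]

open Classical in
theorem green_eq (A : Set V) (x y : V) :
    green G A x y = if x ∈ A then 0
      else (if x = y then 1 else 0) + ∑' v, step G x v * green G A v y := by
  simp_rw [green_eq_tsum]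
  rw [tsum_eq_zero_add' ENNReal.summable, killed_zero]
  simp_rw [killed_succ]
  by_cases hx : x ∈ A
  · simp [hx]
  · simp only [hx, if_false, ← ENNReal.tsum_mul_left, not_false_eq_true, and_true]
    rw [ENNReal.tsum_comm]

theorem deg_mul_step_comm (hlf : ∀ x, (G.neighborSet x).Finite) (x y : V) :
    (deg G x : ℝ≥0∞) * step G x y = deg G y * step G y x := by
  classical
  have key : ∀ u v, G.Adj u v → (deg G u : ℝ≥0∞) * (deg G u : ℝ≥0∞)⁻¹ = 1 := by
    intro u v huv
    refine ENNReal.mul_inv_cancel ?_ (ENNReal.natCast_ne_top _)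
    rw [Nat.cast_ne_zero, deg]
    exact (Set.ncard_pos (hlf u)).2 ⟨v, huv⟩ |>.ne'
  unfold step
  by_cases hxy : G.Adj x y
  · rw [if_pos hxy, if_pos hxy.symm, key x y hxy, key y x hxy.symm]
  · rw [if_neg hxy, if_neg (fun h => hxy h.symm), mul_zero, mul_zero]

/-- Reversibility of the killed walk with respect to the degree. -/
theorem deg_mul_killed_comm (hlf : ∀ x, (G.neighborSet x).Finite) (A : Set V) (n : ℕ) (x y : V) :
    (deg G x : ℝ≥0∞) * killed G A n x y = deg G y * killed G A n y x := by
  classical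
  induction n generalizing x with
  | zero =>
    by_cases hxy : x = y
    · rw [hxy]
    · simp [killed_zero, hxy, Ne.symm hxy]
  | succ n ih =>
    rw [killed_succ, killed_succ_right]
    split_ifs with hx
    · simp
    rw [← ENNReal.tsum_mul_left, ← ENNReal.tsum_mul_left]
    refine tsum_congr fun v => ?_
    rw [← mul_assoc, deg_mul_step_comm hlf, mul_right_comm, ih, mul_assoc]

theorem deg_mul_green_comm (hlf : ∀ x, (G.neighborSet x).Finite) (A : Set V) (x y : V) :
    (deg G x : ℝ≥0∞) * green G A x y = deg G y * green G A y x := by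
  simp_rw [green_eq_tsum, ← ENNReal.tsum_mul_left, deg_mul_killed_comm hlf A _ x y]

theorem killed_eq_zero_of_mem_right {A : Set V} {y : V} (hy : y ∈ A) (n : ℕ) (x : V) :
    killed G A n x y = 0 := by
  classical
  cases n with
  | zero =>
    rw [killed_zero, if_neg]
    rintro ⟨rfl, h⟩; exact h hy
  | succ n => rw [killed_succ_right, if_pos hy]

theorem green_eq_zero_of_mem_left {A : Set V} {x : V} (hx : x ∈ A) (y : V) :
    green G A x y = 0 := by
  classical
  rw [green_eq, if_pos hx]

theorem green_eq_zero_of_mem_right {A : Set V} {y : V} (hy : y ∈ A) (x : V) :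
    green G A x y = 0 := by
  simp [green_eq_tsum, killed_eq_zero_of_mem_right hy]

end WalkRecursion

/-! ### The maximum principle in a recurrent graph -/

section MaximumPrinciple

variable {V : Type*} {G : SimpleGraph V}

/-- The standing assumptions on a deterministic graph: connected, locally finite, recurrent. -/
structure IsNice (G : SimpleGraph V) : Prop where
  connected : G.Connected
  finite : ∀ x, (G.neighborSet x).Finite
  recurrent : IsRecurrent G

/-- The averaging operator `(P f)(x) = ∑_v p(x, v) f(v)` on real functions. The sum has finite
support when the graph is locally finite. -/
def avg (G : SimpleGraph V) (f : V → ℝ) (x : V) : ℝ := ∑' v, (step G x v).toReal * f v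

theorem step_eq_zero {x v : V} (h : ¬ G.Adj x v) : step G x v = 0 := by
  simp [step, h]

namespace IsNice

theorem avg_eq_sum (h : IsNice G) (f : V → ℝ) (x : V) :
    avg G f x = ∑ v ∈ (h.finite x).toFinset, (step G x v).toReal * f v := by
  refine tsum_eq_sum fun v hv => ?_
  rw [step_eq_zero (by simpa using hv), ENNReal.toReal_zero, zero_mul]

theorem deg_pos [Nontrivial V] (h : IsNice G) (x : V) : 0 < deg G x := by
  obtain ⟨v, hv⟩ := h.connected.preconnected.exists_adj_of_nontrivial x
  exact (Set.ncard_pos (h.finite x)).2 ⟨v, hv⟩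

theorem tsum_step [Nontrivial V] (h : IsNice G) (x : V) : ∑' v, step G x v = 1 := by
  classical
  rw [tsum_eq_sum (s := (h.finite x).toFinset)
    (fun v hv => step_eq_zero (by simpa using hv))]
  have : ∀ v ∈ (h.finite x).toFinset, step G x v = (deg G x : ℝ≥0∞)⁻¹ := fun v hv => by
    simp only [Set.Finite.mem_toFinset, SimpleGraph.mem_neighborSet] at hv
    simp [step, hv]
  rw [Finset.sum_congr rfl this, Finset.sum_const, ← Set.ncard_eq_toFinset_card _ (h.finite x),
    nsmul_eq_mul]
  exact ENNReal.mul_inv_cancel (by exact_mod_cast (h.deg_pos x).ne') (ENNReal.natCast_ne_top _)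

theorem step_ne_top [Nontrivial V] (h : IsNice G) (x v : V) : step G x v ≠ ∞ :=
  ne_top_of_le_ne_top ENNReal.one_ne_top ((ENNReal.le_tsum v).trans (h.tsum_step x).le)

theorem step_toReal_pos [Nontrivial V] (h : IsNice G) {x v : V} (hxv : G.Adj x v) :
    0 < (step G x v).toReal := by
  refine ENNReal.toReal_pos ?_ (h.step_ne_top x v)
  simp [step, hxv]

theorem avg_toReal [Nontrivial V] (h : IsNice G) {F : V → ℝ≥0∞} (hF : ∀ v, F v ≠ ∞) (x : V) :
    (∑' v, step G x v * F v).toReal = avg G (fun v => (F v).toReal) x := by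
  rw [ENNReal.tsum_toReal_eq fun v => ENNReal.mul_ne_top (h.step_ne_top x v) (hF v)]
  simp [avg]

theorem avg_const [Nontrivial V] (h : IsNice G) (c : ℝ) (x : V) : avg G (fun _ => c) x = c := by
  have := h.avg_toReal (F := fun _ => 1) (by simp) x
  simp only [mul_one, h.tsum_step x, ENNReal.toReal_one] at this
  rw [avg, tsum_mul_right]
  simp only [avg, mul_one] at this
  rw [← this, one_mul]

theorem avg_sub (h : IsNice G) (f k : V → ℝ) (x : V) :
    avg G (fun v => f v - k v) x = avg G f x - avg G k x := by
  simp [h.avg_eq_sum, mul_sub, Finset.sum_sub_distrib]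

theorem avg_add (h : IsNice G) (f k : V → ℝ) (x : V) :
    avg G (fun v => f v + k v) x = avg G f x + avg G k x := by
  simp [h.avg_eq_sum, mul_add, Finset.sum_add_distrib]

theorem avg_const_mul (c : ℝ) (f : V → ℝ) (x : V) :
    avg G (fun v => c * f v) x = c * avg G f x := by
  simp only [avg, ← tsum_mul_left]
  exact tsum_congr fun v => by ring

theorem avg_mono (h : IsNice G) {f k : V → ℝ} (hfk : ∀ v, f v ≤ k v) (x : V) :
    avg G f x ≤ avg G k x := by
  simp only [h.avg_eq_sum]
  exact Finset.sum_le_sum fun v _ => mul_le_mul_of_nonneg_left (hfk v) ENNReal.toReal_nonneg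

theorem tendsto_avg (h : IsNice G) {ι : Type*} {l : Filter ι} {f : ι → V → ℝ} {k : V → ℝ}
    (hf : ∀ v, Tendsto (fun i => f i v) l (𝓝 (k v))) (x : V) :
    Tendsto (fun i => avg G (f i) x) l (𝓝 (avg G k x)) := by
  simp only [h.avg_eq_sum]
  exact tendsto_finsetSum _ fun v _ => (hf v).const_mul _

theorem induction_on_adj (h : IsNice G) {p : V → Prop} {x₀ : V} (h₀ : p x₀)
    (hs : ∀ x y, G.Adj x y → p x → p y) (y : V) : p y := by
  obtain ⟨w⟩ := h.connected.preconnected x₀ y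
  induction w with
  | nil => exact h₀
  | cons hadj _ ih => exact ih (hs _ _ hadj h₀)

/-- The strong maximum principle: a subharmonic function which attains its maximum is constant. -/
theorem eq_of_subharmonic_of_max [Nontrivial V] (h : IsNice G) {f : V → ℝ} {M : ℝ}
    (hM : ∀ v, f v ≤ M) (hf : ∀ v, f v ≤ avg G f v) {x₀ : V} (h₀ : f x₀ = M) (y : V) : f y = M := by
  refine h.induction_on_adj (p := fun y => f y = M) h₀ (fun x y hxy hx => ?_) y
  by_contra hy
  have hlt : avg G f x < avg G (fun _ => M) x := by
    simp only [h.avg_eq_sum]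
    refine Finset.sum_lt_sum
      (fun v _ => mul_le_mul_of_nonneg_left (hM v) ENNReal.toReal_nonneg)
      ⟨y, by simpa using hxy, ?_⟩
    exact mul_lt_mul_of_pos_left (lt_of_le_of_ne (hM y) hy) (h.step_toReal_pos hxy)
  rw [h.avg_const] at hlt
  linarith [hf x]

theorem sum_hitAt_succ (B : Set V) {w : V} (hw : w ∈ B) (n : ℕ) (u : V) :
    ∑ k ∈ Finset.range (n + 1), hitAt G B k u w = open Classical in
      if u ∈ B then (if u = w then 1 else 0)
      else ∑' v, step G u v * ∑ k ∈ Finset.range n, hitAt G B k v w := by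
  classical
  rw [Finset.sum_range_succ', hitAt_zero]
  simp_rw [hitAt_succ]
  by_cases hu : u ∈ B
  · simp [hu]
  · have : u ≠ w := fun h => hu (h ▸ hw)
    simp only [hu, this, if_false, add_zero, Finset.mul_sum]
    rw [Summable.tsum_finsetSum fun _ _ => ENNReal.summable]

theorem sum_hitAt_le_one [Nontrivial V] (h : IsNice G) {B : Set V} {w : V} (hw : w ∈ B) (n : ℕ)
    (u : V) : ∑ k ∈ Finset.range n, hitAt G B k u w ≤ 1 := by
  classical
  induction n generalizing u with
  | zero => simp
  | succ n ih =>
    rw [sum_hitAt_succ B hw]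
    split_ifs
    · exact le_rfl
    · exact zero_le_one
    · calc ∑' v, step G u v * ∑ k ∈ Finset.range n, hitAt G B k v w
          ≤ ∑' v, step G u v := ENNReal.tsum_le_tsum fun v => mul_le_of_le_one_right' (ih v)
        _ = 1 := h.tsum_step u

theorem hitProb_le_one [Nontrivial V] (h : IsNice G) {B : Set V} {w : V} (hw : w ∈ B) (u : V) :
    hitProb G B u w ≤ 1 :=
  ENNReal.tsum_le_of_sum_range_le fun n => h.sum_hitAt_le_one hw n u

theorem hitProb_ne_top [Nontrivial V] (h : IsNice G) {B : Set V} {w : V} (hw : w ∈ B) (u : V) :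
    hitProb G B u w ≠ ∞ :=
  ne_top_of_le_ne_top ENNReal.one_ne_top (h.hitProb_le_one hw u)

theorem avg_hitProb [Nontrivial V] (h : IsNice G) {B : Set V} {w : V} (hw : w ∈ B) {u : V}
    (hu : u ∉ B) :
    avg G (fun v => (hitProb G B v w).toReal) u = (hitProb G B u w).toReal := by
  classical
  rw [← h.avg_toReal (h.hitProb_ne_top hw), hitProb_eq B hw u, if_neg hu]

/-- In a connected recurrent graph, the walk started anywhere hits each vertex: the hitting
probability is harmonic away from `b` by the Markov property and at `b` by recurrence, so it is
constant by the maximum principle. -/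
theorem hitProb_singleton [Nontrivial V] (h : IsNice G) (b u : V) : hitProb G {b} u b = 1 := by
  classical
  have hb : b ∈ ({b} : Set V) := rfl
  have hbb : hitProb G {b} b b = 1 := hitProb_self hb
  have key := h.eq_of_subharmonic_of_max (f := fun u => (hitProb G {b} u b).toReal) (M := 1)
    (fun v => by simpa using ENNReal.toReal_mono ENNReal.one_ne_top (h.hitProb_le_one hb v))
    (fun v => by
      by_cases hv : v = b
      · rw [← h.avg_toReal (h.hitProb_ne_top hb), hv, ← returnProb_eq, h.recurrent b, hbb]
      · rw [h.avg_hitProb hb (by simpa using hv)])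
    (x₀ := b) (by simp [hbb]) u
  rwa [← ENNReal.toReal_one, ENNReal.toReal_eq_toReal_iff' (h.hitProb_ne_top hb u) (by simp)] at key

/-- The maximum principle in a recurrent graph: a function bounded above, subharmonic off a
nonempty set `B` and nonpositive on `B` is nonpositive. It is at most `M ℙ_u (T_b ≥ n)` for `b ∈ B`
and every `n`. -/
theorem nonpos_of_subharmonic [Nontrivial V] (h : IsNice G) {B : Set V} {b : V} (hb : b ∈ B)
    {f : V → ℝ} {M : ℝ} (hM : ∀ u, f u ≤ M) (hB : ∀ u ∈ B, f u ≤ 0)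
    (hf : ∀ u, u ∉ B → f u ≤ avg G f u) (u : V) : f u ≤ 0 := by
  classical
  have hbb : b ∈ ({b} : Set V) := rfl
  set σ : ℕ → V → ℝ≥0∞ := fun n u => ∑ k ∈ Finset.range n, hitAt G {b} k u b with hσ
  have hσ1 : ∀ n u, σ n u ≤ 1 := fun n u => h.sum_hitAt_le_one hbb n u
  have hσt : ∀ n u, σ n u ≠ ∞ := fun n u => ne_top_of_le_ne_top ENNReal.one_ne_top (hσ1 n u)
  have hσr : ∀ n u, (σ n u).toReal ≤ 1 := fun n u => by
    simpa using ENNReal.toReal_mono ENNReal.one_ne_top (hσ1 n u)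
  set M' := max M 0
  have hM' : 0 ≤ M' := le_max_right _ _
  have key : ∀ n u, f u ≤ M' * (1 - (σ n u).toReal) := by
    intro n
    induction n with
    | zero =>
      intro u
      have h0 : f u ≤ M' := (hM u).trans (le_max_left M 0)
      simpa only [hσ, Finset.range_zero, Finset.sum_empty, ENNReal.toReal_zero, sub_zero,
        mul_one] using h0
    | succ n ih =>
      intro u
      by_cases hu : u ∈ B
      · exact (hB u hu).trans (mul_nonneg hM' (by linarith [hσr (n + 1) u]))
      · have hub : u ∉ ({b} : Set V) := by rintro rfl; exact hu hb
        have hs : (σ (n + 1) u).toReal = avg G (fun v => (σ n v).toReal) u := by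
          rw [← h.avg_toReal (hσt n), hσ]
          simp only
          rw [sum_hitAt_succ _ hbb, if_neg hub]
        calc f u ≤ avg G f u := hf u hu
          _ ≤ avg G (fun v => M' * (1 - (σ n v).toReal)) u := h.avg_mono ih u
          _ = M' * (1 - (σ (n + 1) u).toReal) := by
              rw [avg_const_mul, h.avg_sub, h.avg_const, hs]
  have hlim : Tendsto (fun n => M' * (1 - (σ n u).toReal)) atTop (𝓝 (M' * (1 - 1))) := by
    have h1 : Tendsto (fun n => σ n u) atTop (𝓝 1) := by
      rw [← h.hitProb_singleton b u]
      exact ENNReal.summable.hasSum.tendsto_sum_nat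
    have h2 := (ENNReal.tendsto_toReal ENNReal.one_ne_top).comp h1
    simp only [ENNReal.toReal_one] at h2
    exact (h2.const_sub 1).const_mul M'
  rw [sub_self, mul_zero] at hlim
  exact ge_of_tendsto' hlim fun n => key n u

/-- The comparison principle for bounded functions with the same Laplacian off `B`. -/
theorem eq_of_harmonic_diff [Nontrivial V] (h : IsNice G) {B : Set V} {b : V} (hb : b ∈ B)
    {f k : V → ℝ} {M M' : ℝ} (hf : ∀ u, |f u| ≤ M) (hk : ∀ u, |k u| ≤ M')
    (hB : ∀ u ∈ B, f u = k u) (hfk : ∀ u, u ∉ B → f u - avg G f u = k u - avg G k u) (u : V) :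
    f u = k u := by
  have h1 := h.nonpos_of_subharmonic hb (f := fun v => f v - k v) (M := M + M')
    (fun v => by linarith [abs_le.1 (hf v), abs_le.1 (hk v)]) (fun v hv => by simp [hB v hv])
    (fun v hv => by rw [h.avg_sub]; linarith [hfk v hv]) u
  have h2 := h.nonpos_of_subharmonic hb (f := fun v => k v - f v) (M := M + M')
    (fun v => by linarith [abs_le.1 (hf v), abs_le.1 (hk v)]) (fun v hv => by simp [hB v hv])
    (fun v hv => by rw [h.avg_sub]; linarith [hfk v hv]) u
  linarith

end IsNice

end MaximumPrinciple

/-! ### Green functions, effective resistance and truncated potentials -/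

section Green

variable {V : Type*} {G : SimpleGraph V}

theorem normGreen_self_left (z y : V) : normGreen G {z} z y = 0 := by
  simp [normGreen, green_eq_zero_of_mem_left (Set.mem_singleton z)]

theorem normGreen_nonneg (A : Set V) (x y : V) : 0 ≤ normGreen G A x y :=
  div_nonneg ENNReal.toReal_nonneg (Nat.cast_nonneg _)

/-- The effective resistance between `x` and `y`, expressed as a Green function at `x` of the walk
killed at `y`. -/
def resistance (G : SimpleGraph V) (x y : V) : ℝ := normGreen G {y} x x

open Classical in
theorem sum_killed_succ (A : Set V) (n : ℕ) (x y : V) :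
    ∑ k ∈ Finset.range (n + 1), killed G A k x y = if x ∈ A then 0
      else (if x = y then 1 else 0) +
        ∑' v, step G x v * ∑ k ∈ Finset.range n, killed G A k v y := by
  rw [Finset.sum_range_succ', killed_zero]
  simp_rw [killed_succ]
  by_cases hx : x ∈ A
  · simp [hx]
  · simp only [hx, if_false, not_false_eq_true, and_true, Finset.mul_sum]
    rw [Summable.tsum_finsetSum fun _ _ => ENNReal.summable, add_comm]

namespace IsNice

variable [Nontrivial V]

theorem killed_le_one (h : IsNice G) (A : Set V) (n : ℕ) (x y : V) : killed G A n x y ≤ 1 := by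
  classical
  induction n generalizing x with
  | zero => rw [killed_zero]; split_ifs <;> simp
  | succ n ih =>
    rw [killed_succ]
    split_ifs
    · exact zero_le_one
    · calc ∑' v, step G x v * killed G A n v y
          ≤ ∑' v, step G x v := ENNReal.tsum_le_tsum fun v => mul_le_of_le_one_right' (ih v)
        _ = 1 := h.tsum_step x

theorem sum_killed_le (h : IsNice G) (A : Set V) (n : ℕ) (x y : V) :
    ∑ k ∈ Finset.range n, killed G A k x y ≤ n := by
  calc ∑ k ∈ Finset.range n, killed G A k x y ≤ ∑ k ∈ Finset.range n, 1 :=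
        Finset.sum_le_sum fun k _ => h.killed_le_one A k x y
    _ = n := by simp

theorem sum_killed_ne_top (h : IsNice G) (A : Set V) (n : ℕ) (x y : V) :
    ∑ k ∈ Finset.range n, killed G A k x y ≠ ∞ :=
  ne_top_of_le_ne_top (ENNReal.natCast_ne_top n) (h.sum_killed_le A n x y)

open Classical in
/-- Partial sums of the Green function are subsolutions of the Poisson equation. -/
theorem sum_killed_le_avg (h : IsNice G) (A : Set V) (n : ℕ) {x : V} (hx : x ∉ A) (y : V) :
    (∑ k ∈ Finset.range n, killed G A k x y).toReal ≤ (if x = y then 1 else 0) +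
      avg G (fun v => (∑ k ∈ Finset.range n, killed G A k v y).toReal) x := by
  have h1 : ∑ k ∈ Finset.range n, killed G A k x y ≤
      ∑ k ∈ Finset.range (n + 1), killed G A k x y :=
    Finset.sum_le_sum_of_subset (Finset.range_subset_range.2 n.le_succ)
  have h2 := ENNReal.toReal_mono (h.sum_killed_ne_top A (n + 1) x y) h1
  refine h2.trans (le_of_eq ?_)
  have hne : ∑' v, step G x v * ∑ k ∈ Finset.range n, killed G A k v y ≠ ∞ := by
    refine ne_top_of_le_ne_top (ENNReal.natCast_ne_top n) ?_
    calc _ ≤ ∑' v, step G x v * (n : ℝ≥0∞) :=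
          ENNReal.tsum_le_tsum fun v => mul_le_mul_right (h.sum_killed_le A n v y) _
      _ = n := by rw [ENNReal.tsum_mul_right, h.tsum_step, one_mul]
  rw [sum_killed_succ, if_neg hx, ENNReal.toReal_add (by split_ifs <;> simp) hne,
    h.avg_toReal (fun v => h.sum_killed_ne_top A n v y)]
  split_ifs <;> simp

/-- The Green function of the recurrent walk killed at `z` is bounded. Let `s` be the probability
of hitting `y` before `z`, and `e = 1 - P s(y)` the escape probability, which is positive by the
maximum principle. The partial sums are dominated by `s / e`, by the maximum principle again. -/
theorem exists_green_le (h : IsNice G) (z y : V) :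
    ∃ C : ℝ, ∀ x, green G {z} x y ≤ ENNReal.ofReal C := by
  classical
  by_cases hzy : y = z
  · exact ⟨0, fun x => by rw [green_eq_zero_of_mem_right (by simpa using hzy)]; exact zero_le⟩
  have hyB : y ∈ ({y, z} : Set V) := by simp
  set s : V → ℝ := fun u => (hitProb G {y, z} u y).toReal with hs
  have hsy : s y = 1 := by simp [hs, hitProb_self hyB]
  have hsz : s z = 0 := by simp [hs, hitProb_of_mem_of_ne hyB _ (Ne.symm hzy)]
  have hs1 : ∀ u, s u ≤ 1 := fun u => by
    simpa using ENNReal.toReal_mono ENNReal.one_ne_top (h.hitProb_le_one hyB u)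
  have hs0 : ∀ u, 0 ≤ s u := fun u => ENNReal.toReal_nonneg
  have hharm : ∀ u, u ≠ y → u ≠ z → avg G s u = s u := fun u h1 h2 =>
    h.avg_hitProb hyB (by simp [h1, h2])
  have he : 0 < 1 - avg G s y := by
    by_contra hcon
    have := h.nonpos_of_subharmonic (B := {z}) (Set.mem_singleton z) (f := s) hs1
      (by simp [hsz]) (fun u hu => by
        by_cases huy : u = y
        · rw [huy, hsy]; linarith
        · rw [hharm u huy (by simpa using hu)]) y
    linarith
  set e := 1 - avg G s y with hedef
  refine ⟨e⁻¹, fun x => ENNReal.tsum_le_of_sum_range_le fun n => ?_⟩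
  have key := h.nonpos_of_subharmonic (B := {z}) (Set.mem_singleton z)
    (f := fun u => (∑ k ∈ Finset.range n, killed G {z} k u y).toReal - e⁻¹ * s u) (M := n)
    (fun u => by
      have h1 := ENNReal.toReal_mono (ENNReal.natCast_ne_top n) (h.sum_killed_le {z} n u y)
      have h2 := mul_nonneg (inv_nonneg.2 he.le) (hs0 u)
      rw [ENNReal.toReal_natCast] at h1
      linarith)
    (fun u hu => by
      have hu : u = z := hu
      subst hu
      have : ∑ k ∈ Finset.range n, killed G {u} k u y ≤ 0 :=
        (ENNReal.sum_le_tsum _).trans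
          (green_eq_zero_of_mem_left (G := G) (Set.mem_singleton u) y).le
      rw [le_zero_iff.1 this, hsz]; simp)
    (fun u hu => by
      rw [h.avg_sub, avg_const_mul]
      have h1 := h.sum_killed_le_avg {z} n hu y
      have h2 : e⁻¹ * s u = (if u = y then 1 else 0) + e⁻¹ * avg G s u := by
        split_ifs with huy
        · have : avg G s y = 1 - e := by rw [hedef]; ring
          rw [huy, hsy, this, mul_sub, inv_mul_cancel₀ he.ne']
          ring
        · rw [hharm u huy (by simpa using hu), zero_add]
      linarith) x
  have h3 : (∑ k ∈ Finset.range n, killed G {z} k x y).toReal ≤ e⁻¹ := by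
    have : e⁻¹ * s x ≤ e⁻¹ * 1 := mul_le_mul_of_nonneg_left (hs1 x) (inv_nonneg.2 he.le)
    linarith
  refine (ENNReal.ofReal_toReal (h.sum_killed_ne_top {z} n x y)).symm.le.trans ?_
  exact ENNReal.ofReal_le_ofReal h3

theorem green_ne_top (h : IsNice G) (z x y : V) : green G {z} x y ≠ ∞ := by
  obtain ⟨C, hC⟩ := h.exists_green_le z y
  exact ne_top_of_le_ne_top ENNReal.ofReal_ne_top (hC x)

theorem exists_abs_normGreen_le (h : IsNice G) (z y : V) :
    ∃ C : ℝ, ∀ x, |normGreen G {z} x y| ≤ C := by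
  obtain ⟨C, hC⟩ := h.exists_green_le z y
  refine ⟨max C 0 / deg G y, fun x => ?_⟩
  rw [abs_of_nonneg (normGreen_nonneg _ _ _), normGreen]
  gcongr
  calc (green G {z} x y).toReal ≤ (ENNReal.ofReal C).toReal :=
        ENNReal.toReal_mono ENNReal.ofReal_ne_top (hC x)
    _ = max C 0 := ENNReal.toReal_ofReal' 

theorem deg_real_pos (h : IsNice G) (x : V) : (0 : ℝ) < deg G x := by exact_mod_cast h.deg_pos x

open Classical in
/-- The Poisson equation for the normalised Green function. -/
theorem normGreen_eq (h : IsNice G) {z x : V} (hx : x ≠ z) (y : V) :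
    normGreen G {z} x y = (if x = y then (deg G y : ℝ)⁻¹ else 0) +
      avg G (fun v => normGreen G {z} v y) x := by
  have hne : ∑' v, step G x v * green G {z} v y ≠ ∞ := by
    refine ne_top_of_le_ne_top (h.green_ne_top z x y) ?_
    rw [green_eq {z} x, if_neg (by simpa using hx)]
    exact le_add_self
  have h1 : (green G {z} x y).toReal = (if x = y then 1 else 0) +
      avg G (fun v => (green G {z} v y).toReal) x := by
    rw [green_eq, if_neg (by simpa using hx), ENNReal.toReal_add (by split_ifs <;> simp) hne,
      h.avg_toReal fun v => h.green_ne_top z v y]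
    split_ifs <;> simp
  have h2 : (fun v => normGreen G {z} v y) =
      fun v => (deg G y : ℝ)⁻¹ * (green G {z} v y).toReal := by
    ext v; rw [normGreen, div_eq_inv_mul]
  rw [h2, avg_const_mul, normGreen, div_eq_inv_mul, h1]
  split_ifs <;> ring

theorem normGreen_comm (h : IsNice G) (z x y : V) :
    normGreen G {z} x y = normGreen G {z} y x := by
  have := congrArg ENNReal.toReal (deg_mul_green_comm h.finite {z} x y)
  simp only [ENNReal.toReal_mul, ENNReal.toReal_natCast] at this
  rw [normGreen, normGreen, div_eq_div_iff (h.deg_real_pos y).ne' (h.deg_real_pos x).ne']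
  linarith

/-- The total flow into the killing vertex: the walk from `y` is absorbed at `z` almost surely. -/
theorem avg_normGreen_self (h : IsNice G) {z y : V} (hzy : y ≠ z) :
    avg G (fun v => normGreen G {z} v y) z = (deg G z : ℝ)⁻¹ := by
  classical
  have key : (deg G z : ℝ≥0∞) * ∑' v, step G z v * green G {z} v y = deg G y := by
    have hsum : ∑' n, hitAt G {z} (n + 1) y z = 1 := by
      have := h.hitProb_singleton z y
      rw [hitProb_eq_tsum, tsum_eq_zero_add' ENNReal.summable, hitAt_zero, if_neg hzy,
        zero_add] at this
      exact this
    calc (deg G z : ℝ≥0∞) * ∑' v, step G z v * green G {z} v y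
        = ∑' v, deg G y * (green G {z} y v * step G v z) := by
          rw [← ENNReal.tsum_mul_left]
          refine tsum_congr fun v => ?_
          rw [← mul_assoc, deg_mul_step_comm h.finite, mul_right_comm,
            deg_mul_green_comm h.finite, mul_assoc]
      _ = deg G y * ∑' n, hitAt G {z} (n + 1) y z := by
          rw [ENNReal.tsum_mul_left]
          congr 1
          simp_rw [hitAt_singleton_succ, green_eq_tsum, ← ENNReal.tsum_mul_right]
          rw [ENNReal.tsum_comm]
      _ = deg G y := by rw [hsum, mul_one]
  have h1 := congrArg ENNReal.toReal key
  rw [ENNReal.toReal_mul, h.avg_toReal fun v => h.green_ne_top z v y] at h1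
  simp only [ENNReal.toReal_natCast] at h1
  have h2 : (fun v => normGreen G {z} v y) =
      fun v => (deg G y : ℝ)⁻¹ * (green G {z} v y).toReal := by
    ext v; rw [normGreen, div_eq_inv_mul]
  have hy := h.deg_real_pos y
  have hz := h.deg_real_pos z
  rw [h2, avg_const_mul]
  field_simp
  linarith

/-- The truncated potential is a Green function with the roles of `y` and `z` exchanged: both sides
vanish at `y` and have the same Laplacian elsewhere. -/
theorem truncPotential_eq (h : IsNice G) {y z : V} (hyz : y ≠ z) (x : V) :
    truncPotential G {z} x y = normGreen G {y} x z := by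
  classical
  obtain ⟨C, hC⟩ := h.exists_abs_normGreen_le z y
  obtain ⟨C', hC'⟩ := h.exists_abs_normGreen_le y z
  have hC2 : ∀ u, |truncPotential G {z} u y| ≤ C + C := fun u =>
    (abs_sub _ _).trans (add_le_add (hC y) (hC u))
  refine h.eq_of_harmonic_diff (B := {y}) (Set.mem_singleton y) hC2 hC' ?_ ?_ x
  · rintro u (rfl : u = y)
    rw [normGreen_self_left, truncPotential, sub_self]
  · intro u hu
    have hu : u ≠ y := hu
    have h1 : avg G (fun u => truncPotential G {z} u y) u =
        normGreen G {z} y y - avg G (fun u => normGreen G {z} u y) u := by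
      simp only [truncPotential]
      rw [h.avg_sub, h.avg_const]
    rw [h1, h.normGreen_eq hu z, truncPotential]
    by_cases huz : u = z
    · rw [huz, normGreen_self_left, h.avg_normGreen_self hyz, if_pos rfl]; ring
    · rw [if_neg huz, h.normGreen_eq huz y, if_neg hu]; ring

theorem truncPotential_nonneg (h : IsNice G) {y z : V} (hyz : y ≠ z) (x : V) :
    0 ≤ truncPotential G {z} x y := by
  rw [h.truncPotential_eq hyz]; exact normGreen_nonneg _ _ _

theorem resistance_comm (h : IsNice G) {y z : V} (hyz : y ≠ z) :
    resistance G y z = resistance G z y := by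
  have := h.truncPotential_eq hyz z
  rw [truncPotential, normGreen_self_left, sub_zero] at this
  exact this

theorem resistance_pos (h : IsNice G) {x y : V} (hxy : x ≠ y) : 0 < resistance G x y := by
  classical
  rw [resistance, h.normGreen_eq hxy, if_pos rfl]
  refine add_pos_of_pos_of_nonneg (inv_pos.2 (h.deg_real_pos x)) ?_
  have := h.avg_mono (f := fun _ => 0) (fun v => normGreen_nonneg (G := G) {y} v x) x
  rwa [h.avg_const] at this

/-- Strong Markov property at the hitting time of `{x, y}`. -/
theorem hitProb_mul_resistance (h : IsNice G) {x y : V} (hxy : x ≠ y) (u : V) :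
    (hitProb G {y, x} u x).toReal * resistance G x y = normGreen G {y} u x := by
  classical
  have hxB : x ∈ ({y, x} : Set V) := by simp
  obtain ⟨C, hC⟩ := h.exists_abs_normGreen_le y x
  have hs1 : ∀ u, (hitProb G {y, x} u x).toReal ≤ 1 := fun u => by
    simpa using ENNReal.toReal_mono ENNReal.one_ne_top (h.hitProb_le_one hxB u)
  refine h.eq_of_harmonic_diff hxB (M := resistance G x y)
    (f := fun u => (hitProb G {y, x} u x).toReal * resistance G x y)
    (fun v => ?_) hC ?_ ?_ u
  · rw [abs_of_nonneg (mul_nonneg ENNReal.toReal_nonneg (h.resistance_pos hxy).le)]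
    exact mul_le_of_le_one_left (h.resistance_pos hxy).le (hs1 v)
  · rintro v (rfl | rfl)
    · simp [hitProb_of_mem_of_ne hxB _ hxy.symm, normGreen_self_left]
    · simp [hitProb_self hxB, resistance]
  · intro v hv
    have hv' : v ≠ y ∧ v ≠ x := by simpa using hv
    have : (fun u => (hitProb G {y, x} u x).toReal * resistance G x y) =
      fun u => resistance G x y * (hitProb G {y, x} u x).toReal := by ext; ring
    rw [h.normGreen_eq hv'.1, if_neg hv'.2, this, avg_const_mul, h.avg_hitProb hxB hv]
    ring

/-- `ℙ_z (T_x < T_y)` in terms of the potential truncated at `z`. -/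
theorem hitProb_mul_resistance_eq_truncPotential (h : IsNice G) {x y z : V} (hxy : x ≠ y)
    (hyz : y ≠ z) :
    (hitProb G {y, x} z x).toReal * resistance G x y = truncPotential G {z} x y := by
  rw [h.hitProb_mul_resistance hxy, h.truncPotential_eq hyz, h.normGreen_comm]

/-- The effective resistance is the symmetrised potential. At the starting point `z` this says that
the probabilities of hitting `x` first and of hitting `y` first add up to one. -/
theorem truncPotential_add_comm (h : IsNice G) {x y z : V} (hxy : x ≠ y) (hxz : x ≠ z)
    (hyz : y ≠ z) :
    truncPotential G {z} x y + truncPotential G {z} y x = resistance G x y := by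
  classical
  obtain ⟨C, hC⟩ := h.exists_abs_normGreen_le y x
  obtain ⟨C', hC'⟩ := h.exists_abs_normGreen_le x y
  have key := h.eq_of_harmonic_diff (B := {x, y}) (b := x) (by simp)
    (f := fun u => normGreen G {y} u x + normGreen G {x} u y) (k := fun _ => resistance G x y)
    (M := C + C') (M' := |resistance G x y|)
    (fun u => (abs_add_le _ _).trans (add_le_add (hC u) (hC' u))) (fun _ => le_rfl)
    (by
      rintro u (rfl | rfl)
      · simp [normGreen_self_left, resistance]
      · simp only [normGreen_self_left, zero_add]
        exact (h.resistance_comm hxy).symm)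
    (fun u hu => by
      have hu' : u ≠ x ∧ u ≠ y := by simpa using hu
      rw [h.avg_const, h.avg_add, h.normGreen_eq hu'.2, if_neg hu'.1, h.normGreen_eq hu'.1,
        if_neg hu'.2]
      ring) z
  rw [h.truncPotential_eq hyz, h.truncPotential_eq hxz, h.normGreen_comm, h.normGreen_comm x y]
  exact key

/-- The difference of two truncated potentials is harmonic off their poles. -/
theorem abs_truncPotential_sub_le (h : IsNice G) {y w z : V} (hyw : y ≠ w) (hyz : y ≠ z)
    (hwz : w ≠ z) (x : V) :
    |truncPotential G {z} x y - truncPotential G {z} x w| ≤ resistance G y w := by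
  classical
  obtain ⟨C, hC⟩ := h.exists_abs_normGreen_le y z
  obtain ⟨C', hC'⟩ := h.exists_abs_normGreen_le w z
  have hR := h.truncPotential_add_comm hyw hyz hwz
  have hny := h.truncPotential_nonneg hyz w
  have hnw := h.truncPotential_nonneg hwz y
  have hB : ∀ u ∈ ({y, w} : Set V),
      |truncPotential G {z} u y - truncPotential G {z} u w| ≤ resistance G y w := by
    have h0 : ∀ u, truncPotential G {z} u u = 0 := fun u => sub_self _
    rintro u (rfl | rfl)
    · rw [h0, zero_sub, abs_neg, abs_of_nonneg hnw]; linarith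
    · rw [h0, sub_zero, abs_of_nonneg hny]; linarith
  simp only [h.truncPotential_eq hyz, h.truncPotential_eq hwz] at hB ⊢
  have hav : ∀ u ∉ ({y, w} : Set V), avg G (fun u => normGreen G {y} u z - normGreen G {w} u z) u =
      normGreen G {y} u z - normGreen G {w} u z := fun u hu => by
    have hu' : u ≠ y ∧ u ≠ w := by simpa using hu
    rw [h.avg_sub, h.normGreen_eq hu'.1, h.normGreen_eq hu'.2]
    ring
  have h1 := h.nonpos_of_subharmonic (B := {y, w}) (b := y) (by simp)
    (f := fun u => (normGreen G {y} u z - normGreen G {w} u z) - resistance G y w)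
    (M := C + C' - resistance G y w)
    (fun u => by linarith [abs_le.1 (hC u), abs_le.1 (hC' u)])
    (fun u hu => by linarith [abs_le.1 (hB u hu)])
    (fun u hu => by rw [h.avg_sub _ (fun _ => resistance G y w), h.avg_const, hav u hu]) x
  have h2 := h.nonpos_of_subharmonic (B := {y, w}) (b := y) (by simp)
    (f := fun u => (-1) * (normGreen G {y} u z - normGreen G {w} u z) - resistance G y w)
    (M := C + C' - resistance G y w)
    (fun u => by linarith [abs_le.1 (hC u), abs_le.1 (hC' u)])
    (fun u hu => by linarith [abs_le.1 (hB u hu)])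
    (fun u hu => by
      rw [h.avg_sub _ (fun _ => resistance G y w), h.avg_const, avg_const_mul, hav u hu]) x
  rw [abs_le]
  constructor <;> linarith

/-- The truncated potential is antisymmetric up to a coboundary. -/
theorem truncPotential_sub_comm (h : IsNice G) (x y z : V) :
    truncPotential G {z} x y - truncPotential G {z} y x =
      normGreen G {z} y y - normGreen G {z} x x := by
  rw [truncPotential, truncPotential, h.normGreen_comm z y x]; ring

/-- The truncated potential is superharmonic off its pole, so that it is bounded below by its
value at `w` times the probability of hitting `w` before the pole. -/
theorem hitProb_mul_truncPotential_le (h : IsNice G) {y w z : V} (hyz : y ≠ z) (hyw : y ≠ w)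
    (x : V) :
    (hitProb G {y, w} x w).toReal * truncPotential G {z} w y ≤ truncPotential G {z} x y := by
  classical
  have hwB : w ∈ ({y, w} : Set V) := by simp
  have hs1 : ∀ u, (hitProb G {y, w} u w).toReal ≤ 1 := fun u => by
    simpa using ENNReal.toReal_mono ENNReal.one_ne_top (h.hitProb_le_one hwB u)
  have hn := h.truncPotential_nonneg hyz
  have key := h.nonpos_of_subharmonic hwB
    (f := fun u => truncPotential G {z} w y * (hitProb G {y, w} u w).toReal -
      truncPotential G {z} u y) (M := truncPotential G {z} w y)
    (fun u => by linarith [mul_le_of_le_one_right (hn w) (hs1 u), hn u])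
    (by
      rintro u (rfl | rfl)
      · simp [hitProb_of_mem_of_ne hwB _ hyw, truncPotential]
      · simp [hitProb_self hwB])
    (fun u hu => by
      have hu' : u ≠ y ∧ u ≠ w := by simpa using hu
      rw [h.avg_sub, avg_const_mul, h.avg_hitProb hwB hu]
      simp only [h.truncPotential_eq hyz]
      have h1 := h.normGreen_eq hu'.1 z
      have h2 : (0 : ℝ) ≤ if u = z then (deg G z : ℝ)⁻¹ else 0 := by
        split_ifs
        · exact inv_nonneg.2 (Nat.cast_nonneg _)
        · exact le_rfl
      linarith) x
  linarith

end IsNice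

end Green

/-! ### Potential kernel and harmonic measure from infinity -/

section Kernel

variable {V : Type*} {G : SimpleGraph V}

theorem inv_two_eq_ofReal : (2⁻¹ : ℝ≥0∞) = ENNReal.ofReal 2⁻¹ := by
  rw [ENNReal.ofReal_inv_of_pos two_pos, ENNReal.ofReal_ofNat]

theorem finite_walk_length (hlf : ∀ x, (G.neighborSet x).Finite) (r : ℕ) (o : V) :
    {v | ∃ w : G.Walk o v, w.length = r}.Finite := by
  induction r generalizing o with
  | zero =>
    refine (Set.finite_singleton o).subset ?_
    rintro v ⟨w, hw⟩
    exact (SimpleGraph.Walk.eq_of_length_eq_zero hw).symm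
  | succ r ih =>
    refine ((hlf o).biUnion fun u _ => ih u).subset ?_
    rintro v ⟨w, hw⟩
    cases w with
    | nil => simp at hw
    | cons hadj w' =>
      simp only [Set.mem_iUnion]
      exact ⟨_, hadj, w', by simpa using hw⟩

theorem finite_dist_lt (hc : G.Connected) (hlf : ∀ x, (G.neighborSet x).Finite) (r : ℕ) (o : V) :
    {v | G.dist o v < r}.Finite := by
  refine ((Finset.range r).finite_toSet.biUnion fun n _ => finite_walk_length hlf n o).subset ?_
  intro v hv
  obtain ⟨w, hw⟩ := hc.exists_walk_length_eq_dist o v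
  simp only [Set.mem_iUnion]
  exact ⟨G.dist o v, by simpa using hv, w, hw⟩

/-- For graphs labelled by `ℕ`, the truncated potentials of singletons converge to the potential
kernel. -/
theorem IsPotentialKernel.tendsto_singleton {G : SimpleGraph ℕ} (hc : G.Connected)
    (hlf : ∀ x, (G.neighborSet x).Finite) {o : ℕ} {a : ℕ → ℕ → ℝ} (ha : IsPotentialKernel G o a)
    (x y : ℕ) : Tendsto (fun z => truncPotential G {z} x y) cofinite (𝓝 (a x y)) := by
  rw [Nat.cofinite_eq_atTop]
  have := ha (fun n => {n}) (fun n => Finset.singleton_nonempty n) (fun r => by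
    have : ∀ᶠ n in cofinite, r ≤ G.dist o n := by
      have := (finite_dist_lt hc hlf r o).eventually_cofinite_notMem
      exact this.mono fun n hn => not_lt.1 hn
    rw [Nat.cofinite_eq_atTop] at this
    simpa using this) x y
  simpa using this

theorem eventually_ne_cofinite (u : V) : ∀ᶠ x in cofinite, u ≠ x :=
  (Set.finite_singleton u).eventually_cofinite_notMem.mono fun _ hx => Ne.symm hx

theorem finite_sublevel {a : V → V → ℝ} (hlim : ∀ z, Tendsto (fun x => a x z) cofinite atTop)
    (z : V) (R : ℝ) :
    (sublevel a z R).Finite := by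
  have := (hlim z).eventually_gt_atTop R
  rw [eventually_cofinite] at this
  exact this.subset fun x hx => by simpa [sublevel] using hx

theorem isExhaustion_sublevel {a : V → V → ℝ}
    (hlim : ∀ z, Tendsto (fun x => a x z) cofinite atTop) (z : V) :
    IsExhaustion (sublevel a z) :=
  ⟨fun R _ => finite_sublevel hlim z R, fun _ _ _ hRR' _ hx => le_trans hx hRR',
    fun x => ⟨max 1 (a x z), le_max_left _ _, le_max_right 1 (a x z)⟩⟩

/-- The probability of hitting `x` before `o` for a walk started at infinity, as an upper limit, so
that it is defined for every graph and depends measurably on it. It is the harmonic measure of `x`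
in `{o, x}` whenever that exists. -/
def hmInfinity (G : SimpleGraph V) (o x : V) : ℝ≥0∞ :=
  limsup (fun z => hitProb G {o, x} z x) cofinite

/-- The upper limit, as `x → ∞`, of the harmonic measure of `x` in `{o, x}`. -/
def hmLimsup (G : SimpleGraph V) (o : V) : ℝ≥0∞ :=
  limsup (fun x => hmInfinity G o x) cofinite

namespace IsNice

/-- Recurrence as divergence of the Green function of the whole graph. If it were finite, it would
be maximal at `o` by the maximum principle, and minimal there as well since it is superharmonic; but
a constant does not solve the Poisson equation at `o`. -/
theorem green_empty [Nontrivial V] (h : IsNice G) (o : V) : green G ∅ o o = ∞ := by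
  classical
  by_contra hcon
  have hmax : ∀ n u, (∑ k ∈ Finset.range n, killed G ∅ k u o).toReal ≤
      (∑ k ∈ Finset.range n, killed G ∅ k o o).toReal := by
    intro n u
    have := h.nonpos_of_subharmonic (B := {o}) (Set.mem_singleton o)
      (f := fun u => (∑ k ∈ Finset.range n, killed G ∅ k u o).toReal -
        (∑ k ∈ Finset.range n, killed G ∅ k o o).toReal) (M := n)
      (fun u => by
        have h1 := ENNReal.toReal_mono (ENNReal.natCast_ne_top n) (h.sum_killed_le ∅ n u o)
        rw [ENNReal.toReal_natCast] at h1
        linarith [ENNReal.toReal_nonneg (a := ∑ k ∈ Finset.range n, killed G ∅ k o o)])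
      (by rintro u (rfl : u = o); simp)
      (fun u hu => by
        have hu : u ≠ o := hu
        have h1 := h.sum_killed_le_avg ∅ n (Set.notMem_empty u) o
        rw [if_neg hu, zero_add] at h1
        rw [h.avg_sub _ (fun _ => (∑ k ∈ Finset.range n, killed G ∅ k o o).toReal), h.avg_const]
        linarith) u
    linarith
  have hle : ∀ u, green G ∅ u o ≤ green G ∅ o o := fun u =>
    ENNReal.tsum_le_of_sum_range_le fun n =>
      ((ENNReal.toReal_le_toReal (h.sum_killed_ne_top ∅ n u o)
        (h.sum_killed_ne_top ∅ n o o)).1 (hmax n u)).trans (ENNReal.sum_le_tsum _)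
  have hfin : ∀ u, green G ∅ u o ≠ ∞ := fun u => ne_top_of_le_ne_top hcon (hle u)
  have heq : ∀ u, (green G ∅ u o).toReal = (if u = o then 1 else 0) +
      avg G (fun v => (green G ∅ v o).toReal) u := by
    intro u
    have hne : ∑' v, step G u v * green G ∅ v o ≠ ∞ := by
      refine ne_top_of_le_ne_top (hfin u) ?_
      rw [green_eq ∅ u, if_neg (Set.notMem_empty u)]
      exact le_add_self
    rw [green_eq, if_neg (Set.notMem_empty u), ENNReal.toReal_add (by split_ifs <;> simp) hne,
      h.avg_toReal hfin]
    split_ifs <;> simp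
  have hge : ∀ u, (green G ∅ o o).toReal ≤ (green G ∅ u o).toReal := by
    intro u
    have := h.nonpos_of_subharmonic (B := {o}) (Set.mem_singleton o)
      (f := fun u => (green G ∅ o o).toReal - (green G ∅ u o).toReal) (M := (green G ∅ o o).toReal)
      (fun u => by linarith [ENNReal.toReal_nonneg (a := green G ∅ u o)])
      (by rintro u (rfl : u = o); simp)
      (fun u hu => by
        have hu : u ≠ o := hu
        have h1 := heq u
        rw [if_neg hu, zero_add] at h1
        rw [h.avg_sub (fun _ => (green G ∅ o o).toReal), h.avg_const, ← h1]) u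
    linarith
  have h1 := heq o
  have h2 := h.avg_mono hge o
  rw [h.avg_const] at h2
  rw [if_pos rfl] at h1
  linarith

/-- In finitely many steps the walk does not notice a far away killing vertex. -/
theorem killed_singleton_eventually (h : IsNice G) (n : ℕ) (u y : V) :
    ∀ᶠ x in cofinite, killed G {x} n u y = killed G ∅ n u y := by
  classical
  induction n generalizing u with
  | zero =>
    filter_upwards [eventually_ne_cofinite u] with x hx
    simp [killed_zero, hx]
  | succ n ih =>
    have h1 : ∀ᶠ x in cofinite, ∀ v ∈ G.neighborSet u, killed G {x} n v y = killed G ∅ n v y :=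
      (eventually_all_finite (h.finite u)).2 fun v _ => ih v
    filter_upwards [eventually_ne_cofinite u, h1] with x hx hv
    rw [killed_succ, killed_succ, if_neg (by simpa using hx), if_neg (Set.notMem_empty u)]
    refine tsum_congr fun v => ?_
    by_cases huv : G.Adj u v
    · rw [hv v huv]
    · rw [step_eq_zero huv, zero_mul, zero_mul]

/-- Recurrence: the effective resistance to infinity is infinite. -/
theorem tendsto_resistance [Nontrivial V] (h : IsNice G) (o : V) :
    Tendsto (fun x => resistance G x o) cofinite atTop := by
  have h1 : Tendsto (fun n => ∑ k ∈ Finset.range n, killed G ∅ k o o) atTop (𝓝 ∞) := by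
    rw [← h.green_empty o]
    exact ENNReal.summable.hasSum.tendsto_sum_nat
  refine tendsto_atTop.2 fun K => ?_
  obtain ⟨n, hn⟩ := (ENNReal.tendsto_nhds_top_iff_nnreal.1 h1 (K * deg G o).toNNReal).exists
  have h2 : ∀ᶠ x in cofinite, ∀ k ∈ Finset.range n, killed G {x} k o o = killed G ∅ k o o :=
    (Finset.eventually_all _).2 fun k _ => h.killed_singleton_eventually k o o
  filter_upwards [h2, (Set.finite_singleton o).eventually_cofinite_notMem] with x hx hxo
  rw [h.resistance_comm hxo, resistance, normGreen, le_div_iff₀ (h.deg_real_pos o)]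
  have h3 : ENNReal.ofReal (K * deg G o) ≤ green G {x} o o := by
    refine hn.le.trans ?_
    rw [← Finset.sum_congr rfl hx]
    exact ENNReal.sum_le_tsum _
  exact (ENNReal.ofReal_le_iff_le_toReal (h.green_ne_top x o o)).1 h3

theorem hmInfinity_self [Nontrivial V] [Infinite V] (h : IsNice G) (o : V) :
    hmInfinity G o o = 1 := by
  have : ∀ z, hitProb G {o, o} z o = 1 := fun z => by
    rw [Set.pair_eq_singleton]; exact h.hitProb_singleton o z
  simp only [hmInfinity, this, limsup_const]

section Limit

variable [Infinite V] {a : V → V → ℝ}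

theorem kernel_nonneg (h : IsNice G)
    (ha : ∀ x y, Tendsto (fun z => truncPotential G {z} x y) cofinite (𝓝 (a x y))) (x y : V) :
    0 ≤ a x y :=
  ge_of_tendsto (ha x y) ((eventually_ne_cofinite y).mono fun _ hz => h.truncPotential_nonneg hz x)

theorem kernel_add_comm (h : IsNice G)
    (ha : ∀ x y, Tendsto (fun z => truncPotential G {z} x y) cofinite (𝓝 (a x y))) {x y : V}
    (hxy : x ≠ y) : a x y + a y x = resistance G x y := by
  refine tendsto_nhds_unique (((ha x y).add (ha y x)).congr' ?_) tendsto_const_nhds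
  filter_upwards [eventually_ne_cofinite x, eventually_ne_cofinite y] with z hx hy
  exact h.truncPotential_add_comm hxy hx hy

theorem abs_kernel_sub_le (h : IsNice G)
    (ha : ∀ x y, Tendsto (fun z => truncPotential G {z} x y) cofinite (𝓝 (a x y))) {y w : V}
    (hyw : y ≠ w) (x : V) : |a x y - a x w| ≤ resistance G y w := by
  refine le_of_tendsto ((ha x y).sub (ha x w)).abs ?_
  filter_upwards [eventually_ne_cofinite y, eventually_ne_cofinite w] with z hy hw
  exact h.abs_truncPotential_sub_le hyw hy hw x

/-- The antisymmetric part of the potential kernel is a cocycle. -/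
theorem kernel_cocycle (h : IsNice G)
    (ha : ∀ x y, Tendsto (fun z => truncPotential G {z} x y) cofinite (𝓝 (a x y))) (x y w : V) :
    (a x y - a y x) + (a y w - a w y) = a x w - a w x := by
  refine tendsto_nhds_unique ((((ha x y).sub (ha y x)).add ((ha y w).sub (ha w y))).congr ?_)
    ((ha x w).sub (ha w x))
  intro z
  rw [h.truncPotential_sub_comm, h.truncPotential_sub_comm, h.truncPotential_sub_comm]
  ring

theorem abs_resistance_sub_le (h : IsNice G)
    (ha : ∀ x y, Tendsto (fun z => truncPotential G {z} x y) cofinite (𝓝 (a x y))) {x y w : V}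
    (hyw : y ≠ w) (hxy : x ≠ y) (hxw : x ≠ w) :
    |resistance G x y - resistance G x w| ≤ 3 * resistance G y w := by
  have h1 := abs_le.1 (h.abs_kernel_sub_le ha hyw x)
  have h2 := h.kernel_cocycle ha x y w
  have h3 := h.kernel_add_comm ha hxy
  have h4 := h.kernel_add_comm ha hxw
  have h5 := h.kernel_add_comm ha hyw
  have h6 := h.kernel_nonneg ha y w
  have h7 := h.kernel_nonneg ha w y
  rw [abs_le]
  constructor <;> linarith

theorem hitProb_mul_kernel_le (h : IsNice G)
    (ha : ∀ x y, Tendsto (fun z => truncPotential G {z} x y) cofinite (𝓝 (a x y))) {y w : V}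
    (hyw : y ≠ w) (x : V) : (hitProb G {y, w} x w).toReal * a w y ≤ a x y := by
  refine le_of_tendsto_of_tendsto ((ha w y).const_mul _) (ha x y) ?_
  filter_upwards [eventually_ne_cofinite y] with z hz
  exact h.hitProb_mul_truncPotential_le hz hyw x

/-- The harmonic measure from infinity of a pair of vertices exists, and is given by the potential
kernel. -/
theorem tendsto_hitProb (h : IsNice G)
    (ha : ∀ x y, Tendsto (fun z => truncPotential G {z} x y) cofinite (𝓝 (a x y))) {x y : V}
    (hxy : x ≠ y) : Tendsto (fun z => hitProb G {y, x} z x) cofinite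
      (𝓝 (ENNReal.ofReal (a x y / resistance G x y))) := by
  refine (ENNReal.tendsto_ofReal ((ha x y).div_const (resistance G x y))).congr' ?_
  filter_upwards [eventually_ne_cofinite y] with z hz
  rw [← h.hitProb_mul_resistance_eq_truncPotential hxy hz,
    mul_div_cancel_right₀ _ (h.resistance_pos hxy).ne',
    ENNReal.ofReal_toReal (h.hitProb_ne_top (by simp) z)]

theorem hmInfinity_eq (h : IsNice G)
    (ha : ∀ x y, Tendsto (fun z => truncPotential G {z} x y) cofinite (𝓝 (a x y))) {x y : V}
    (hxy : x ≠ y) : hmInfinity G y x = ENNReal.ofReal (a x y / resistance G x y) :=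
  (h.tendsto_hitProb ha hxy).limsup_eq

/-- One of two vertices has harmonic measure at least one half. -/
theorem half_le_hmInfinity (h : IsNice G)
    (ha : ∀ x y, Tendsto (fun z => truncPotential G {z} x y) cofinite (𝓝 (a x y))) (x y : V) :
    2⁻¹ ≤ hmInfinity G y x ∨ 2⁻¹ ≤ hmInfinity G x y := by
  by_cases hxy : x = y
  · left
    rw [hxy, h.hmInfinity_self]
    exact ENNReal.inv_le_one.2 one_le_two
  have hR := h.resistance_pos hxy
  have hsum : a x y / resistance G x y + a y x / resistance G x y = 1 := by
    rw [← add_div, h.kernel_add_comm ha hxy, div_self hR.ne']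
  rw [h.hmInfinity_eq ha hxy, h.hmInfinity_eq ha (Ne.symm hxy), inv_two_eq_ofReal,
    ← h.resistance_comm hxy]
  rcases le_total (2⁻¹ : ℝ) (a x y / resistance G x y) with h3 | h3
  · exact Or.inl (ENNReal.ofReal_le_ofReal h3)
  · refine Or.inr (ENNReal.ofReal_le_ofReal ?_)
    norm_num at h3 ⊢
    linarith

theorem kernel_div_le_add (h : IsNice G)
    (ha : ∀ x y, Tendsto (fun z => truncPotential G {z} x y) cofinite (𝓝 (a x y))) {x y w : V}
    (hyw : y ≠ w) (hxy : x ≠ y) (hxw : x ≠ w) :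
    a x y / resistance G x y ≤
      a x w / resistance G x w + 4 * resistance G y w / resistance G x w := by
  have hR := h.resistance_pos hxy
  have hR' := h.resistance_pos hxw
  have h1 := abs_le.1 (h.abs_kernel_sub_le ha hyw x)
  have h2 := abs_le.1 (h.abs_resistance_sub_le ha hyw hxy hxw)
  have h3 := h.kernel_add_comm ha hxy
  have h4 := h.kernel_nonneg ha x y
  have h5 := h.kernel_nonneg ha y x
  have hC := (h.resistance_pos hyw).le
  rw [← add_div, div_le_div_iff₀ hR hR']
  -- `a R' ≤ a R + 3 a C ≤ (a' + C) R + 3 R C`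
  nlinarith [mul_le_mul_of_nonneg_left h2.1 h4, mul_le_mul_of_nonneg_right h1.2 hR.le,
    mul_nonneg h5 hC]

/-- The harmonic measures of a far away vertex seen from two roots are asymptotically equal, since
the resistance to infinity is infinite. -/
theorem hmLimsup_le (h : IsNice G)
    (ha : ∀ x y, Tendsto (fun z => truncPotential G {z} x y) cofinite (𝓝 (a x y))) (y w : V) :
    hmLimsup G y ≤ hmLimsup G w := by
  by_cases hyw : y = w
  · rw [hyw]
  refine le_of_forall_lt fun c hc => ?_
  obtain ⟨c₁, hc₁, hc₁'⟩ := exists_between hc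
  obtain ⟨c₂, hc₂, hc₂'⟩ := exists_between hc₁
  refine hc₂.trans_le ?_
  have hfreq : ∃ᶠ x in cofinite, c₁ < hmInfinity G y x :=
    frequently_lt_of_lt_limsup (by isBoundedDefault) hc₁'
  refine le_limsup_of_frequently_le ?_ (by isBoundedDefault)
  have h0 : Tendsto (fun x => ENNReal.ofReal (4 * resistance G y w / resistance G x w)) cofinite
      (𝓝 0) := by
    rw [← ENNReal.ofReal_zero]
    exact ENNReal.tendsto_ofReal (tendsto_const_nhds.div_atTop (h.tendsto_resistance w))
  have hev : ∀ᶠ x in cofinite,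
      ENNReal.ofReal (4 * resistance G y w / resistance G x w) < c₁ - c₂ :=
    h0.eventually (gt_mem_nhds (tsub_pos_of_lt hc₂'))
  refine (hfreq.and_eventually (hev.and
    ((eventually_ne_cofinite y).and (eventually_ne_cofinite w)))).mono ?_
  rintro x ⟨hx, hx', hxy, hxw⟩
  have h1 : hmInfinity G y x ≤ hmInfinity G w x +
      ENNReal.ofReal (4 * resistance G y w / resistance G x w) := by
    rw [h.hmInfinity_eq ha hxy.symm, h.hmInfinity_eq ha hxw.symm, ← ENNReal.ofReal_add]
    · exact ENNReal.ofReal_le_ofReal (h.kernel_div_le_add ha hyw hxy.symm hxw.symm)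
    · exact div_nonneg (h.kernel_nonneg ha x w) (h.resistance_pos hxw.symm).le
    · exact div_nonneg (mul_nonneg (by norm_num) (h.resistance_pos hyw).le)
        (h.resistance_pos hxw.symm).le
  by_contra hlt
  have h2 : hmInfinity G w x + ENNReal.ofReal (4 * resistance G y w / resistance G x w) <
      c₂ + (c₁ - c₂) := ENNReal.add_lt_add (not_le.1 hlt) hx'
  rw [add_tsub_cancel_of_le hc₂'.le] at h2
  exact lt_irrefl _ ((hx.trans_le h1).trans h2)

theorem hmLimsup_eq (h : IsNice G)
    (ha : ∀ x y, Tendsto (fun z => truncPotential G {z} x y) cofinite (𝓝 (a x y))) (y w : V) :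
    hmLimsup G y = hmLimsup G w :=
  le_antisymm (h.hmLimsup_le ha y w) (h.hmLimsup_le ha w y)

theorem isDeltaGood (h : IsNice G)
    (ha : ∀ x y, Tendsto (fun z => truncPotential G {z} x y) cofinite (𝓝 (a x y))) {o : V}
    (hL : 2⁻¹ ≤ hmLimsup G o) {δ : ℝ} (hδ : δ < 1 / 2) : IsDeltaGood G o δ := by
  intro ε hε
  rw [← frequently_cofinite_iff_infinite]
  have hlt : ENNReal.ofReal (δ - ε) < hmLimsup G o := by
    refine lt_of_lt_of_le ?_ hL
    rw [inv_two_eq_ofReal]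
    exact (ENNReal.ofReal_lt_ofReal_iff (by norm_num)).2 (by norm_num at hδ ⊢; linarith)
  refine ((frequently_lt_of_lt_limsup (by isBoundedDefault) hlt).and_eventually
    (eventually_ne_cofinite o)).mono ?_
  rintro x ⟨hx, hxo⟩
  refine ⟨a x o / resistance G x o, ⟨h.tendsto_hitProb ha hxo.symm,
    div_nonneg (h.kernel_nonneg ha x o) (h.resistance_pos hxo.symm).le⟩, ?_⟩
  rw [h.hmInfinity_eq ha hxo.symm] at hx
  have hx' := (ENNReal.lt_ofReal_iff_toReal_lt ENNReal.ofReal_ne_top).1 hx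
  rw [ENNReal.toReal_ofReal'] at hx'
  exact (le_max_left _ _).trans hx'.le

/-- If far away vertices `w` have harmonic measure bounded below, then the potential kernel is
proper: `a(x, z) ≥ ℙ_x (T_w < T_z) a(w, z)`, where the first factor is bounded below for `x` far
away, and the second factor is large as it is comparable to the resistance between `w` and `z`. -/
theorem tendsto_kernel (h : IsNice G)
    (ha : ∀ x y, Tendsto (fun z => truncPotential G {z} x y) cofinite (𝓝 (a x y))) {z : V}
    (hL : 2⁻¹ ≤ hmLimsup G z) : Tendsto (fun x => a x z) cofinite atTop := by
  refine tendsto_atTop.2 fun K => ?_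
  have hlt : ENNReal.ofReal (1 / 4) < hmLimsup G z := by
    refine lt_of_lt_of_le ?_ hL
    rw [inv_two_eq_ofReal]
    exact (ENNReal.ofReal_lt_ofReal_iff (by norm_num)).2 (by norm_num)
  obtain ⟨w, hw, hwz, hwR⟩ := ((frequently_lt_of_lt_limsup (by isBoundedDefault) hlt).and_eventually
    ((eventually_ne_cofinite z).and
      ((h.tendsto_resistance z).eventually_ge_atTop (16 * |K|)))).exists
  rw [h.hmInfinity_eq ha hwz.symm] at hw
  have hR := h.resistance_pos hwz.symm
  have hev : ∀ᶠ x in cofinite, ENNReal.ofReal (1 / 4) < hitProb G {z, w} x w :=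
    (h.tendsto_hitProb ha hwz.symm).eventually (lt_mem_nhds hw)
  have hw' : 1 / 4 ≤ a w z / resistance G w z :=
    ((ENNReal.ofReal_lt_ofReal_iff_of_nonneg (by norm_num)).1 hw).le
  rw [le_div_iff₀ hR] at hw'
  filter_upwards [hev] with x hx
  have h1 : 1 / 4 ≤ (hitProb G {z, w} x w).toReal :=
    (ENNReal.ofReal_le_iff_le_toReal (h.hitProb_ne_top (by simp) x)).1 hx.le
  have h2 := h.hitProb_mul_kernel_le ha hwz x
  have h3 : 1 / 4 * a w z ≤ (hitProb G {z, w} x w).toReal * a w z :=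
    mul_le_mul_of_nonneg_right h1 (h.kernel_nonneg ha w z)
  linarith [le_abs_self K]

end Limit

end IsNice

end Kernel

/-! ### Null recurrence -/

section Cesaro

variable {V : Type*} {G : SimpleGraph V}

namespace IsNice

theorem tsum_killed_empty [Nontrivial V] (h : IsNice G) (n : ℕ) (x : V) :
    ∑' y, killed G ∅ n x y = 1 := by
  classical
  induction n generalizing x with
  | zero =>
    rw [tsum_eq_single x]
    · simp [killed_zero]
    · intro y hy
      rw [killed_zero, if_neg fun h => hy h.1.symm]
  | succ n ih =>
    simp_rw [killed_succ, if_neg (Set.notMem_empty x)]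
    rw [ENNReal.tsum_comm]
    simp_rw [ENNReal.tsum_mul_left, ih, mul_one]
    exact h.tsum_step x

/-- The walk leaves every vertex on average. A limit point of the Cesàro means of the transition
probabilities `p_n(x, o)` is a bounded harmonic function of `x`, hence constant by recurrence, and
its sum against the degree is at most `deg o`, hence it vanishes. -/
theorem tendsto_cesaro [Infinite V] (h : IsNice G) (o x : V) :
    Tendsto (fun N : ℕ => (∑ n ∈ Finset.range N, killed G ∅ n x o).toReal / N) atTop (𝓝 0) := by
  classical
  set q : ℕ → V → ℝ := fun N x => (∑ n ∈ Finset.range N, killed G ∅ n x o).toReal / N with hq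
  have hne : ∀ N x, ∑ n ∈ Finset.range N, killed G ∅ n x o ≠ ∞ := fun N x =>
    h.sum_killed_ne_top ∅ N x o
  have hk : ∀ n x y, (killed G ∅ n x y).toReal ≤ 1 := fun n x y => by
    simpa using ENNReal.toReal_mono ENNReal.one_ne_top (h.killed_le_one ∅ n x y)
  have hkt : ∀ n x y, killed G ∅ n x y ≠ ∞ := fun n x y =>
    ne_top_of_le_ne_top ENNReal.one_ne_top (h.killed_le_one ∅ n x y)
  have hq0 : ∀ N x, 0 ≤ q N x := fun N x => div_nonneg ENNReal.toReal_nonneg (Nat.cast_nonneg N)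
  have hq1 : ∀ N x, q N x ≤ 1 := fun N x => by
    refine div_le_one_of_le₀ ?_ (Nat.cast_nonneg N)
    simpa using ENNReal.toReal_mono (ENNReal.natCast_ne_top N) (h.sum_killed_le ∅ N x o)
  have hharm : ∀ x, Tendsto (fun N => avg G (q N) x - q N x) atTop (𝓝 0) := by
    intro x
    have hbound : ∀ N : ℕ, |avg G (q N) x - q N x| ≤ 1 / (N : ℝ) := by
      intro N
      have h1 := sum_killed_succ (G := G) ∅ N x o
      rw [if_neg (Set.notMem_empty x), Finset.sum_range_succ] at h1
      have h2 := congrArg ENNReal.toReal h1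
      have hne' : ∑' v, step G x v * ∑ k ∈ Finset.range N, killed G ∅ k v o ≠ ∞ := by
        refine ne_top_of_le_ne_top (hne (N + 1) x) ?_
        rw [Finset.sum_range_succ, h1]
        exact le_add_self
      rw [ENNReal.toReal_add (hne N x) (hkt N x o),
        ENNReal.toReal_add (by split_ifs <;> simp) hne', h.avg_toReal (hne N)] at h2
      have h3 : avg G (q N) x = (N : ℝ)⁻¹ *
          avg G (fun v => (∑ n ∈ Finset.range N, killed G ∅ n v o).toReal) x := by
        rw [← avg_const_mul]
        simp only [hq, div_eq_inv_mul]
      have h4 : avg G (q N) x - q N x = ((killed G ∅ N x o).toReal -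
          (if x = o then (1 : ℝ≥0∞) else 0).toReal) / N := by
        rw [h3]
        simp only [hq, div_eq_inv_mul]
        rw [← mul_sub]
        congr 1
        linarith
      rw [h4, abs_div, Nat.abs_cast]
      refine div_le_div_of_nonneg_right ?_ (Nat.cast_nonneg N)
      have h5 := hk N x o
      have h6 : 0 ≤ (killed G ∅ N x o).toReal := ENNReal.toReal_nonneg
      rw [abs_le]
      constructor <;> split_ifs <;> simp <;> linarith
    exact squeeze_zero_norm hbound tendsto_one_div_atTop_nhds_zero_nat
  have hmass : ∀ N (T : Finset V), ∑ x ∈ T, q N x ≤ deg G o := by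
    intro N T
    have h1 : ∀ n, ∑ x ∈ T, killed G ∅ n x o ≤ deg G o := by
      intro n
      calc ∑ x ∈ T, killed G ∅ n x o ≤ ∑ x ∈ T, deg G x * killed G ∅ n x o := by
            refine Finset.sum_le_sum fun x _ => le_mul_of_one_le_left' ?_
            exact_mod_cast h.deg_pos x
        _ = deg G o * ∑ x ∈ T, killed G ∅ n o x := by
            rw [Finset.mul_sum]
            exact Finset.sum_congr rfl fun x _ => deg_mul_killed_comm h.finite ∅ n x o
        _ ≤ deg G o * 1 := by
            gcongr
            exact (ENNReal.sum_le_tsum T).trans (h.tsum_killed_empty n o).le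
        _ = deg G o := mul_one _
    have h2 : ∑ x ∈ T, ∑ n ∈ Finset.range N, killed G ∅ n x o ≤ (N * deg G o : ℕ) := by
      rw [Finset.sum_comm]
      refine (Finset.sum_le_sum fun n _ => h1 n).trans ?_
      simp
    have h3 := ENNReal.toReal_mono (ENNReal.natCast_ne_top _) h2
    rw [ENNReal.toReal_sum fun x _ => hne N x, ENNReal.toReal_natCast] at h3
    simp only [hq]
    rw [← Finset.sum_div]
    refine div_le_of_le_mul₀ (Nat.cast_nonneg N) (Nat.cast_nonneg _) (h3.trans ?_)
    push_cast
    linarith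
  refine tendsto_iff_ultrafilter _ _ _ |>.2 fun U hU => ?_
  have hlim : ∀ x, ∃ c, Tendsto (fun N => q N x) U (𝓝 c) := by
    intro x
    obtain ⟨c, _, hc⟩ := (isCompact_Icc (a := (0 : ℝ)) (b := 1)).ultrafilter_le_nhds
      (U.map fun N => q N x) (le_principal_iff.2 (by
        rw [Ultrafilter.coe_map, Filter.mem_map]
        exact Filter.univ_mem' fun N => ⟨hq0 N x, hq1 N x⟩))
    exact ⟨c, hc⟩
  choose φ hφ using hlim
  have hφ1 : ∀ x, φ x ≤ 1 := fun x => le_of_tendsto' (hφ x) fun N => hq1 N x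
  have hφ0 : ∀ x, 0 ≤ φ x := fun x => ge_of_tendsto' (hφ x) fun N => hq0 N x
  have hφharm : ∀ x, avg G φ x = φ x := fun x =>
    sub_eq_zero.1 (tendsto_nhds_unique ((h.tendsto_avg hφ x).sub (hφ x)) ((hharm x).mono_left hU))
  have hconst : ∀ u b, φ u ≤ φ b := by
    intro u b
    have := h.nonpos_of_subharmonic (B := {b}) (Set.mem_singleton b) (f := fun u => φ u - φ b)
      (M := 1) (fun v => by linarith [hφ1 v, hφ0 b]) (by rintro v (rfl : v = b); simp)
      (fun v _ => by rw [h.avg_sub _ (fun _ => φ b), h.avg_const, hφharm]) u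
    linarith
  have hzero : φ x ≤ 0 := by
    by_contra hpos
    rw [not_le] at hpos
    obtain ⟨m, hm⟩ := exists_nat_gt (deg G o / φ x)
    obtain ⟨T, hT⟩ := Infinite.exists_subset_card_eq V m
    have h1 : ∑ y ∈ T, φ y ≤ deg G o :=
      le_of_tendsto' (tendsto_finsetSum T fun y _ => hφ y) fun N => hmass N T
    have h2 : ∑ _y ∈ T, φ x ≤ ∑ y ∈ T, φ y := Finset.sum_le_sum fun y _ => hconst x y
    rw [Finset.sum_const, hT, nsmul_eq_mul] at h2
    rw [div_lt_iff₀ hpos] at hm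
    linarith
  have : φ x = 0 := le_antisymm hzero (hφ0 x)
  rw [← this]
  exact hφ x

/-- The proportion of time spent in a finite set tends to zero in mean. -/
theorem tendsto_cesaro_finite [Infinite V] (h : IsNice G) (o : V) {f : V → ℝ≥0∞}
    (hf : ∀ x, f x ≤ 1) (hfin : {x | f x ≠ 0}.Finite) :
    Tendsto (fun N : ℕ => (∑ n ∈ Finset.range N, ∑' x, killed G ∅ n o x * f x) / N) atTop
      (𝓝 0) := by
  set T := hfin.toFinset
  have hdeg : ∀ x, (deg G x : ℝ≥0∞) ≠ 0 := fun x => by exact_mod_cast (h.deg_pos x).ne'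
  have hpt : ∀ x, Tendsto (fun N : ℕ => (∑ n ∈ Finset.range N, killed G ∅ n o x) / N) atTop
      (𝓝 0) := by
    intro x
    have h1 := ENNReal.Tendsto.const_mul (a := (deg G x : ℝ≥0∞) * (deg G o : ℝ≥0∞)⁻¹)
      (ENNReal.tendsto_ofReal (h.tendsto_cesaro o x)) (Or.inr
        (ENNReal.mul_ne_top (ENNReal.natCast_ne_top _) (ENNReal.inv_ne_top.2 (hdeg o))))
    rw [ENNReal.ofReal_zero, mul_zero] at h1
    refine h1.congr' ?_
    filter_upwards [eventually_gt_atTop 0] with N hN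
    rw [ENNReal.ofReal_div_of_pos (by exact_mod_cast hN),
      ENNReal.ofReal_toReal (h.sum_killed_ne_top ∅ N x o), ENNReal.ofReal_natCast, ← mul_div_assoc]
    congr 1
    rw [mul_right_comm, Finset.mul_sum,
      Finset.sum_congr rfl fun n _ => deg_mul_killed_comm h.finite ∅ n x o, ← Finset.mul_sum,
      mul_right_comm, ENNReal.mul_inv_cancel (hdeg o) (ENNReal.natCast_ne_top _), one_mul]
  have hsum := tendsto_finsetSum T fun x _ => hpt x
  rw [Finset.sum_const_zero] at hsum
  refine tendsto_of_tendsto_of_tendsto_of_le_of_le tendsto_const_nhds hsum (fun _ => zero_le) ?_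
  intro N
  simp only [div_eq_mul_inv]
  rw [← Finset.sum_mul, Finset.sum_comm]
  gcongr with n _
  rw [tsum_eq_sum (s := T) fun x hx => by
    have : f x = 0 := by simpa [T] using hx
    rw [this, mul_zero]]
  exact Finset.sum_le_sum fun x _ => mul_le_of_le_one_right' (hf x)

end IsNice

end Cesaro

/-! ### Reversible random graphs -/

section Invariant

/-- A function of a graph and two of its vertices which is invariant under isomorphisms and
measurable as a function of the graph. The root is irrelevant, as the isomorphisms do not have to
preserve it. -/
structure IsInvariantKernel (k : RootedGraph → ℕ → ℕ → ℝ≥0∞) : Prop where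
  iso : ∀ {H K : RootedGraph} (φ : H.graph ≃g K.graph) (x y : ℕ), k K (φ x) (φ y) = k H x y
  meas : ∀ x y, Measurable fun H => k H x y

theorem measurable_adj_root : Measurable fun H : RootedGraph =>
    ((fun x y => H.graph.Adj x y : ℕ → ℕ → Prop), H.root) :=
  comap_measurable _

theorem measurable_root : Measurable RootedGraph.root := measurable_adj_root.snd

theorem measurableSet_adj (x y : ℕ) : MeasurableSet {H : RootedGraph | H.graph.Adj x y} :=
  measurableSet_setOfPred.2
    ((measurable_pi_apply y).comp ((measurable_pi_apply x).comp measurable_adj_root.fst))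

theorem measurable_toRootedGraph : Measurable BirootedGraph.toRootedGraph :=
  (comap_measurable fun G : BirootedGraph => (G.toRootedGraph, G.second)).fst

theorem measurable_second : Measurable BirootedGraph.second :=
  (comap_measurable fun G : BirootedGraph => (G.toRootedGraph, G.second)).snd

theorem measurable_birootedClass (x y : ℕ) :
    Measurable fun H : RootedGraph => H.birootedClass x y := by
  refine measurable_quotient_mk'.comp (g := Quotient.mk birootedSetoid) ?_
  refine measurable_comap_iff.2 (Measurable.prodMk ?_ measurable_const)
  exact measurable_comap_iff.2 (Measurable.prodMk measurable_adj_root.fst measurable_const)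

theorem birootedClass_iso {H K : RootedGraph} (φ : H.graph ≃g K.graph) (x y : ℕ) :
    K.birootedClass (φ x) (φ y) = H.birootedClass x y :=
  (Quotient.sound (s := birootedSetoid) ⟨φ, rfl, rfl⟩ : H.birootedClass x y = _).symm

theorem deg_iso {V W : Type*} {G : SimpleGraph V} {H : SimpleGraph W} (φ : G ≃g H) (x : V) :
    deg H (φ x) = deg G x := by
  have : H.neighborSet (φ x) = φ '' G.neighborSet x := by
    ext y
    obtain ⟨v, rfl⟩ := φ.surjective y
    simpa using φ.map_adj_iff
  rw [deg, this, Set.ncard_image_of_injective _ φ.injective, deg]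

theorem step_iso {V W : Type*} {G : SimpleGraph V} {H : SimpleGraph W} (φ : G ≃g H) (x y : V) :
    step H (φ x) (φ y) = step G x y := by
  classical
  simp only [step, deg_iso, φ.map_adj_iff]

theorem hitAt_iso {V W : Type*} {G : SimpleGraph V} {H : SimpleGraph W} (φ : G ≃g H)
    (o x : V) (n : ℕ) (z : V) :
    hitAt H {φ o, φ x} n (φ z) (φ x) = hitAt G {o, x} n z x := by
  classical
  induction n generalizing z with
  | zero => simp [hitAt_zero]
  | succ n ih =>
    rw [hitAt_succ, hitAt_succ, ← φ.toEquiv.tsum_eq]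
    simp only [Set.mem_insert_iff, Set.mem_singleton_iff, φ.injective.eq_iff,
      RelIso.coe_fn_toEquiv, step_iso, ih]

theorem hitProb_iso {V W : Type*} {G : SimpleGraph V} {H : SimpleGraph W} (φ : G ≃g H)
    (o x z : V) : hitProb H {φ o, φ x} (φ z) (φ x) = hitProb G {o, x} z x := by
  simp_rw [hitProb_eq_tsum, hitAt_iso]

theorem limsup_cofinite_equiv {V W : Type*} (φ : V ≃ W) (u : W → ℝ≥0∞) :
    limsup (fun v => u (φ v)) cofinite = limsup u cofinite := by
  have h : map φ cofinite = cofinite := by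
    refine le_antisymm φ.injective.tendsto_cofinite ?_
    have := map_mono (m := φ) (φ.symm.injective.tendsto_cofinite)
    rwa [map_map, φ.self_comp_symm, map_id] at this
  conv_rhs => rw [← h]
  rfl

theorem hmInfinity_iso {V W : Type*} {G : SimpleGraph V} {H : SimpleGraph W} (φ : G ≃g H)
    (o x : V) : hmInfinity H (φ o) (φ x) = hmInfinity G o x := by
  rw [hmInfinity, ← limsup_cofinite_equiv φ.toEquiv]
  simp only [RelIso.coe_fn_toEquiv, hitProb_iso, hmInfinity]

theorem hmLimsup_iso {V W : Type*} {G : SimpleGraph V} {H : SimpleGraph W} (φ : G ≃g H)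
    (o : V) : hmLimsup H (φ o) = hmLimsup G o := by
  rw [hmLimsup, ← limsup_cofinite_equiv φ.toEquiv]
  simp only [RelIso.coe_fn_toEquiv, hmInfinity_iso, hmLimsup]

theorem measurable_deg (x : ℕ) : Measurable fun H : RootedGraph => (deg H.graph x : ℝ≥0∞) := by
  classical
  have h1 : ∀ H : RootedGraph, (deg H.graph x : ℝ≥0∞) =
      ∑' y, {H : RootedGraph | H.graph.Adj x y}.indicator 1 H := by
    intro H
    rw [tsum_eq_sum (s := (H.locallyFinite x).toFinset) (fun y hy => by
      have : ¬ H.graph.Adj x y := by simpa using hy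
      simp [Set.indicator, this])]
    rw [Finset.sum_congr rfl (g := fun _ => 1) (fun y hy => by
      have : H.graph.Adj x y := by simpa using hy
      simp [Set.indicator, this])]
    rw [Finset.sum_const, deg, Set.ncard_eq_toFinset_card _ (H.locallyFinite x)]
    simp
  simp_rw [h1]
  exact Measurable.tsum fun y => measurable_one.indicator (measurableSet_adj x y)

theorem measurable_step (x y : ℕ) : Measurable fun H : RootedGraph => step H.graph x y := by
  classical
  exact Measurable.ite (measurableSet_adj x y) (measurable_deg x).inv measurable_const

theorem measurable_hitAt (o x : ℕ) (n : ℕ) (z : ℕ) :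
    Measurable fun H : RootedGraph => hitAt H.graph {o, x} n z x := by
  classical
  induction n generalizing z with
  | zero => simp only [hitAt_zero]; exact measurable_const
  | succ n ih =>
    simp only [hitAt_succ]
    split_ifs
    · exact measurable_const
    · exact Measurable.tsum fun v => (measurable_step z v).mul (ih v)

theorem measurable_hmInfinity (o x : ℕ) :
    Measurable fun H : RootedGraph => hmInfinity H.graph o x := by
  simp only [hmInfinity, Nat.cofinite_eq_atTop]
  exact Measurable.limsup fun z => Measurable.tsum fun n => measurable_hitAt o x n z

theorem measurable_hmLimsup (o : ℕ) :
    Measurable fun H : RootedGraph => hmLimsup H.graph o := by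
  simp only [hmLimsup, Nat.cofinite_eq_atTop]
  exact Measurable.limsup fun z => measurable_hmInfinity o z

namespace IsInvariantKernel

variable {k l : RootedGraph → ℕ → ℕ → ℝ≥0∞}

theorem swap (hk : IsInvariantKernel k) : IsInvariantKernel fun H x y => k H y x :=
  ⟨fun φ x y => hk.iso φ y x, fun x y => hk.meas y x⟩

theorem mul (hk : IsInvariantKernel k) (hl : IsInvariantKernel l) :
    IsInvariantKernel fun H x y => k H x y * l H x y :=
  ⟨fun φ x y => by rw [hk.iso, hl.iso], fun x y => (hk.meas x y).mul (hl.meas x y)⟩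

theorem comp (hk : IsInvariantKernel k) (hl : IsInvariantKernel l) :
    IsInvariantKernel fun H x y => ∑' v, k H x v * l H v y where
  iso φ x y := by
    rw [← φ.toEquiv.tsum_eq]
    simp only [RelIso.coe_fn_toEquiv, hk.iso, hl.iso]
  meas x y := Measurable.tsum fun v => (hk.meas x v).mul (hl.meas v y)

theorem step : IsInvariantKernel fun H => step H.graph :=
  ⟨fun φ x y => step_iso φ x y, measurable_step⟩

theorem killed_empty (n : ℕ) : IsInvariantKernel fun H => killed H.graph ∅ n := by
  classical
  induction n with
  | zero =>
    refine ⟨fun φ x y => ?_, fun x y => ?_⟩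
    · simp only [killed_zero, φ.injective.eq_iff, Set.mem_empty_iff_false]
    · simp only [killed_zero]; exact measurable_const
  | succ n ih =>
    have : (fun H : RootedGraph => killed H.graph ∅ (n + 1)) =
        fun H x y => ∑' v, PotKer.step H.graph x v * killed H.graph ∅ n v y := by
      ext H x y
      rw [killed_succ, if_neg (Set.notMem_empty x)]
    rw [this]
    exact step.comp ih

theorem indicator_birootedClass {E : Set BirootedClass} (hE : MeasurableSet E) :
    IsInvariantKernel fun H x y => E.indicator 1 (H.birootedClass x y) :=
  ⟨fun φ x y => by rw [birootedClass_iso],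
    fun x y => (measurable_one.indicator hE).comp (measurable_birootedClass x y)⟩

theorem measurable_root (hk : IsInvariantKernel k) (x : ℕ) :
    Measurable fun H : RootedGraph => k H H.root x := by
  have : Measurable fun p : RootedGraph × ℕ => k p.1 p.2 x :=
    measurable_from_prod_countable_left fun n => hk.meas n x
  exact this.comp (measurable_id.prodMk PotKer.measurable_root)

/-- Sums over the second vertex of an invariant kernel at the root are functions of the isomorphism
class, hence random variables. -/
theorem measurable_tsum {Ω : Type*} [MeasurableSpace Ω] {G : Ω → RootedGraph}
    (hG : IsRandomRootedGraph G) (hk : IsInvariantKernel k) :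
    Measurable fun ω => ∑' x, k (G ω) (G ω).root x := by
  let Φ : RootedClass → ℝ≥0∞ := Quotient.lift (fun H => ∑' x, k H H.root x) (by
    rintro H K ⟨φ, hφ⟩
    rw [← hφ, ← φ.toEquiv.tsum_eq fun x => k K (φ H.root) x]
    simp only [RelIso.coe_fn_toEquiv, hk.iso])
  have hΦ : Measurable Φ :=
    measurable_from_quotient.2 (Measurable.tsum fun x => hk.measurable_root x)
  exact hΦ.comp hG

/-- The function on isomorphism classes defined by an invariant kernel. -/
theorem exists_lift (hk : IsInvariantKernel k) :
    ∃ F : BirootedClass → ℝ≥0∞, Measurable F ∧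
      ∀ (H : RootedGraph) (x y : ℕ), F (H.birootedClass x y) = k H x y := by
  refine ⟨Quotient.lift (fun H : BirootedGraph => k H.toRootedGraph H.root H.second) ?_, ?_, ?_⟩
  · rintro H K ⟨φ, h1, h2⟩
    rw [← h1, ← h2, hk.iso]
  · refine measurable_from_quotient.2 ?_
    have : Measurable fun p : RootedGraph × ℕ => k p.1 p.1.root p.2 :=
      measurable_from_prod_countable_left fun n => hk.measurable_root n
    exact this.comp (measurable_toRootedGraph.prodMk measurable_second)
  · intro H x y
    exact (hk.iso (H := H) (K := ⟨H.graph, H.connected, H.locallyFinite, x⟩)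
      SimpleGraph.Iso.refl x y)

end IsInvariantKernel

section Reversible

variable {Ω : Type*} [MeasurableSpace Ω] {μ : Measure Ω} {G : Ω → RootedGraph}

/-- Reversibility, for functions in place of events. -/
theorem IsReversible.lintegral_step (hrev : IsReversible μ G) (hG : IsRandomRootedGraph G)
    {k : RootedGraph → ℕ → ℕ → ℝ≥0∞} (hk : IsInvariantKernel k) :
    ∫⁻ ω, ∑' x, step (G ω).graph (G ω).root x * k (G ω) (G ω).root x ∂μ =
      ∫⁻ ω, ∑' x, step (G ω).graph (G ω).root x * k (G ω) x (G ω).root ∂μ := by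
  obtain ⟨F, hF, hFk⟩ := hk.exists_lift
  -- the laws of `(G, o, X_1)` and `(G, X_1, o)` given `(G, o)`
  let m : Ω → Measure BirootedClass := fun ω => Measure.sum fun x =>
    step (G ω).graph (G ω).root x • Measure.dirac ((G ω).birootedClass (G ω).root x)
  let m' : Ω → Measure BirootedClass := fun ω => Measure.sum fun x =>
    step (G ω).graph (G ω).root x • Measure.dirac ((G ω).birootedClass x (G ω).root)
  have hmE : ∀ ω {E : Set BirootedClass}, MeasurableSet E → m ω E =
      ∑' x, step (G ω).graph (G ω).root x * E.indicator 1 ((G ω).birootedClass (G ω).root x) := by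
    intro ω E hE
    simp only [m, Measure.sum_apply _ hE, Measure.smul_apply, Measure.dirac_apply' _ hE,
      smul_eq_mul]
  have hmE' : ∀ ω {E : Set BirootedClass}, MeasurableSet E → m' ω E =
      ∑' x, step (G ω).graph (G ω).root x * E.indicator 1 ((G ω).birootedClass x (G ω).root) := by
    intro ω E hE
    simp only [m', Measure.sum_apply _ hE, Measure.smul_apply, Measure.dirac_apply' _ hE,
      smul_eq_mul]
  have hm : Measurable m := Measure.measurable_of_measurable_coe _ fun E hE => by
    simp only [hmE _ hE]
    exact (IsInvariantKernel.step.mul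
      (IsInvariantKernel.indicator_birootedClass hE)).measurable_tsum hG
  have hm' : Measurable m' := Measure.measurable_of_measurable_coe _ fun E hE => by
    simp only [hmE' _ hE]
    exact (IsInvariantKernel.step.mul
      (IsInvariantKernel.indicator_birootedClass hE).swap).measurable_tsum hG
  have heq : μ.bind m = μ.bind m' := by
    ext E hE
    rw [Measure.bind_apply hE hm.aemeasurable, Measure.bind_apply hE hm'.aemeasurable]
    simp only [hmE _ hE, hmE' _ hE]
    exact hrev E hE
  have hint := congrArg (fun M : Measure BirootedClass => ∫⁻ c, F c ∂M) heq
  rw [Measure.lintegral_bind hm.aemeasurable hF.aemeasurable,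
    Measure.lintegral_bind hm'.aemeasurable hF.aemeasurable] at hint
  simpa only [m, m', lintegral_sum_measure, lintegral_smul_measure, lintegral_dirac' _ hF, hFk,
    smul_eq_mul] using hint

/-- Reversibility for the walk at time `n`: `(G, o, X_n)` and `(G, X_n, o)` have the same law. -/
theorem IsReversible.lintegral_killed (hrev : IsReversible μ G) (hG : IsRandomRootedGraph G)
    (n : ℕ) {k : RootedGraph → ℕ → ℕ → ℝ≥0∞} (hk : IsInvariantKernel k) :
    ∫⁻ ω, ∑' x, killed (G ω).graph ∅ n (G ω).root x * k (G ω) (G ω).root x ∂μ =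
      ∫⁻ ω, ∑' x, killed (G ω).graph ∅ n (G ω).root x * k (G ω) x (G ω).root ∂μ := by
  classical
  induction n generalizing k with
  | zero =>
    refine lintegral_congr fun ω => ?_
    refine tsum_congr fun x => ?_
    rw [killed_zero]
    split_ifs with h
    · rw [h.1]
    · simp
  | succ n ih =>
    calc ∫⁻ ω, ∑' y, killed (G ω).graph ∅ (n + 1) (G ω).root y * k (G ω) (G ω).root y ∂μ
        = ∫⁻ ω, ∑' x, step (G ω).graph (G ω).root x *
            ∑' y, k (G ω) (G ω).root y * killed (G ω).graph ∅ n x y ∂μ := by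
          refine lintegral_congr fun ω => ?_
          simp_rw [killed_succ, if_neg (Set.notMem_empty (G ω).root), ← ENNReal.tsum_mul_left,
            ← ENNReal.tsum_mul_right]
          rw [ENNReal.tsum_comm]
          exact tsum_congr fun x => tsum_congr fun y => by ring
      _ = ∫⁻ ω, ∑' x, step (G ω).graph (G ω).root x *
            ∑' y, k (G ω) x y * killed (G ω).graph ∅ n (G ω).root y ∂μ :=
          hrev.lintegral_step hG (hk.comp (IsInvariantKernel.killed_empty n).swap)
      _ = ∫⁻ ω, ∑' y, killed (G ω).graph ∅ n (G ω).root y *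
            ∑' x, step (G ω).graph (G ω).root x * k (G ω) x y ∂μ := by
          refine lintegral_congr fun ω => ?_
          simp_rw [← ENNReal.tsum_mul_left]
          rw [ENNReal.tsum_comm]
          exact tsum_congr fun x => tsum_congr fun y => by ring
      _ = ∫⁻ ω, ∑' y, killed (G ω).graph ∅ n (G ω).root y *
            ∑' x, step (G ω).graph y x * k (G ω) x (G ω).root ∂μ :=
          ih (IsInvariantKernel.step.comp hk)
      _ = ∫⁻ ω, ∑' x, killed (G ω).graph ∅ (n + 1) (G ω).root x * k (G ω) x (G ω).root ∂μ := by
          refine lintegral_congr fun ω => ?_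
          simp_rw [killed_succ_right, if_neg (Set.notMem_empty _), ← ENNReal.tsum_mul_left,
            ← ENNReal.tsum_mul_right]
          rw [ENNReal.tsum_comm]
          exact tsum_congr fun x => tsum_congr fun y => by ring

open Classical in
/-- The indicator that the root `o` has `hmLimsup` less than one half although the harmonic measure
of `x` in `{o, x}` is at least one half. -/
def exceptional (H : RootedGraph) (o x : ℕ) : ℝ≥0∞ :=
  if hmLimsup H.graph o < 2⁻¹ ∧ 2⁻¹ ≤ hmInfinity H.graph o x then 1 else 0

theorem IsInvariantKernel.exceptional : IsInvariantKernel exceptional := by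
  classical
  refine ⟨fun φ x y => ?_, fun x y => ?_⟩
  · simp only [PotKer.exceptional, hmLimsup_iso, hmInfinity_iso]
  · exact Measurable.ite ((measurableSet_lt (measurable_hmLimsup x) measurable_const).inter
      (measurableSet_le measurable_const (measurable_hmInfinity x y))) measurable_const
      measurable_const

theorem exceptional_le_one (H : RootedGraph) (o x : ℕ) : exceptional H o x ≤ 1 := by
  unfold exceptional
  split_ifs <;> simp

theorem finite_exceptional_ne_zero (H : RootedGraph) (o : ℕ) :
    {x | exceptional H o x ≠ 0}.Finite := by
  by_cases ho : hmLimsup H.graph o < 2⁻¹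
  · have := eventually_lt_of_limsup_lt ho (by isBoundedDefault)
    rw [eventually_cofinite] at this
    refine this.subset fun x hx => ?_
    simp only [exceptional, Set.mem_ofPred_eq, ne_eq, ite_eq_right_iff, one_ne_zero, imp_false,
      not_not] at hx
    exact not_lt.2 hx.2
  · simp [exceptional, ho]

/-- In a reversible random graph the harmonic measure from infinity of `{o, x}` gives mass at least
one half to infinitely many `x`, in the limit. Otherwise, on the event that the upper limit is less
than one half, which does not depend on the root, reversibility gives that `X_n` has
harmonic measure at least one half in `{o, X_n}` with conditional probability at least one half for
every `n`. But there are only finitely many such vertices, and the walk leaves them. -/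
theorem IsReversible.half_le_hmLimsup [IsProbabilityMeasure μ] (hrev : IsReversible μ G)
    (hG : IsRandomRootedGraph G) (hrec : ∀ᵐ ω ∂μ, IsRecurrent (G ω).graph)
    (hpot : ∀ᵐ ω ∂μ, ∃ a, IsPotentialKernel (G ω).graph (G ω).root a) :
    ∀ᵐ ω ∂μ, 2⁻¹ ≤ hmLimsup (G ω).graph (G ω).root := by
  classical
  set bad : Ω → ℝ≥0∞ := fun ω => if hmLimsup (G ω).graph (G ω).root < 2⁻¹ then 1 else 0 with hbad
  set D : ℕ → Ω → ℝ≥0∞ := fun n ω =>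
    ∑' x, killed (G ω).graph ∅ n (G ω).root x * exceptional (G ω) (G ω).root x with hD
  have hDm : ∀ n, Measurable (D n) := fun n =>
    ((IsInvariantKernel.killed_empty n).mul IsInvariantKernel.exceptional).measurable_tsum hG
  have hle : ∀ n, ∫⁻ ω, bad ω ∂μ ≤ 2 * ∫⁻ ω, D n ω ∂μ := by
    intro n
    calc ∫⁻ ω, bad ω ∂μ ≤ ∫⁻ ω, D n ω + ∑' x, killed (G ω).graph ∅ n (G ω).root x *
          exceptional (G ω) x (G ω).root ∂μ := by
          refine lintegral_mono_ae ?_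
          filter_upwards [hrec, hpot] with ω hr ⟨a, ha⟩
          have h : IsNice (G ω).graph := ⟨(G ω).connected, (G ω).locallyFinite, hr⟩
          have ha' := ha.tendsto_singleton h.connected h.finite
          simp only [hbad, hD]
          split_ifs with hlt
          · rw [← ENNReal.tsum_add, ← h.tsum_killed_empty n (G ω).root]
            refine ENNReal.tsum_le_tsum fun x => ?_
            rw [← mul_add]
            refine le_mul_of_one_le_right' ?_
            have hlt' : hmLimsup (G ω).graph x < 2⁻¹ := by
              rwa [h.hmLimsup_eq ha' x (G ω).root]
            rcases h.half_le_hmInfinity ha' x (G ω).root with h1 | h1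
            · simp [exceptional, hlt, h1]
            · simp [exceptional, hlt', h1]
          · exact zero_le
      _ = ∫⁻ ω, D n ω ∂μ + ∫⁻ ω, D n ω ∂μ := by
          rw [lintegral_add_left (hDm n),
            ← hrev.lintegral_killed hG n IsInvariantKernel.exceptional]
      _ = 2 * ∫⁻ ω, D n ω ∂μ := (two_mul _).symm
  have hlim : Tendsto (fun N : ℕ => ∫⁻ ω, (∑ n ∈ Finset.range N, D n ω) / N ∂μ) atTop (𝓝 0) := by
    have h0 : ∫⁻ _ω, (0 : ℝ≥0∞) ∂μ = 0 := lintegral_zero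
    rw [← h0]
    refine tendsto_lintegral_of_dominated_convergence' (fun _ => 1)
      (fun N => ((Finset.measurable_sum _ fun n _ => hDm n).div_const _).aemeasurable)
      (fun N => ?_) (by simp) ?_
    · filter_upwards [hrec] with ω hr
      have h : IsNice (G ω).graph := ⟨(G ω).connected, (G ω).locallyFinite, hr⟩
      refine ENNReal.div_le_of_le_mul ?_
      rw [one_mul]
      calc ∑ n ∈ Finset.range N, D n ω ≤ ∑ n ∈ Finset.range N, 1 := by
            refine Finset.sum_le_sum fun n _ => ?_
            rw [← h.tsum_killed_empty n (G ω).root]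
            exact ENNReal.tsum_le_tsum fun x => mul_le_of_le_one_right' (exceptional_le_one _ _ _)
        _ = N := by simp
    · filter_upwards [hrec] with ω hr
      have h : IsNice (G ω).graph := ⟨(G ω).connected, (G ω).locallyFinite, hr⟩
      exact h.tendsto_cesaro_finite (G ω).root (exceptional_le_one _ _)
        (finite_exceptional_ne_zero _ _)
  have hzero : ∫⁻ ω, bad ω ∂μ ≤ 0 := by
    have h2 := ENNReal.Tendsto.const_mul (a := 2) hlim (Or.inr (by simp))
    rw [mul_zero] at h2
    refine ge_of_tendsto h2 ?_
    filter_upwards [eventually_gt_atTop 0] with N hN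
    have hN0 : (N : ℝ≥0∞) ≠ 0 := by exact_mod_cast hN.ne'
    simp only [div_eq_mul_inv]
    rw [lintegral_mul_const _ (Finset.measurable_sum _ fun n _ => hDm n),
      lintegral_finsetSum _ fun n _ => hDm n, ← mul_assoc, ← div_eq_mul_inv,
      ENNReal.le_div_iff_mul_le (Or.inl hN0) (Or.inl (ENNReal.natCast_ne_top N)), Finset.mul_sum]
    calc (∫⁻ ω, bad ω ∂μ) * N = ∑ n ∈ Finset.range N, ∫⁻ ω, bad ω ∂μ := by simp [mul_comm]
      _ ≤ _ := Finset.sum_le_sum fun n _ => hle n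
  have hbadm : Measurable bad := by
    have hk : IsInvariantKernel fun H x y => if x = y then
        (if hmLimsup H.graph x < 2⁻¹ then (1 : ℝ≥0∞) else 0) else 0 := by
      refine ⟨fun φ x y => ?_, fun x y => ?_⟩
      · simp only [φ.injective.eq_iff, hmLimsup_iso]
      · split_ifs
        · exact Measurable.ite (measurableSet_lt (measurable_hmLimsup x) measurable_const)
            measurable_const measurable_const
        · exact measurable_const
    have := hk.measurable_tsum hG
    simpa [hbad] using this
  have hae := (lintegral_eq_zero_iff hbadm).1 (le_antisymm hzero zero_le)
  filter_upwards [hae] with ω hω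
  by_contra hcon
  simp [hbad, not_le.1 hcon] at hω

end Reversible

end Invariant

end PotKer

end

theorem proposition5p1 {Ω : Type*} [MeasurableSpace Ω] (μ : Measure Ω) [IsProbabilityMeasure μ]
    (G : Ω → PotKer.RootedGraph) (hG : PotKer.IsRandomRootedGraph G)
    (hrev : PotKer.IsReversible μ G)
    (hrec : ∀ᵐ ω ∂μ, PotKer.IsRecurrent (G ω).graph)
    (hpot : ∀ᵐ ω ∂μ, ∃ a, PotKer.IsPotentialKernel (G ω).graph (G ω).root a) :
    ∀ᵐ ω ∂μ,
      (∀ a, PotKer.IsPotentialKernel (G ω).graph (G ω).root a → ∀ z : ℕ,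
        (∀ R : ℝ, 1 ≤ R → (PotKer.sublevel a z R).Finite) ∧
        PotKer.IsExhaustion (PotKer.sublevel a z) ∧
        Tendsto (fun x => a x z) cofinite atTop) ∧
      ∀ δ : ℝ, 0 ≤ δ → δ < 1 / 2 → PotKer.IsDeltaGood (G ω).graph (G ω).root δ := by
  filter_upwards [hrec, hpot, hrev.half_le_hmLimsup hG hrec hpot] with ω hr hp hL
  have h : PotKer.IsNice (G ω).graph := ⟨(G ω).connected, (G ω).locallyFinite, hr⟩
  refine ⟨fun a ha z => ?_, fun δ _ hδ => ?_⟩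
  · have ha' := ha.tendsto_singleton h.connected h.finite
    have hlim : ∀ z, Tendsto (fun x => a x z) cofinite atTop := fun z =>
      h.tendsto_kernel ha' (by rwa [h.hmLimsup_eq ha' z (G ω).root])
    exact ⟨fun R _ => PotKer.finite_sublevel hlim z R, PotKer.isExhaustion_sublevel hlim z, hlim z⟩
  · obtain ⟨a, ha⟩ := hp
    exact h.isDeltaGood (ha.tendsto_singleton h.connected h.finite) hL hδ
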